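/- Let $H$ be a semisimple Hopf algebra over an algebraically closed field $k$ of characteristic $0$, with counit $\varepsilon$, antipode $S$ and idempotent integral $\Lambda$ (so $h\Lambda=\Lambda h=\varepsilon(h)\Lambda$ for all $h\in H$, and $\varepsilon(\Lambda)=1$). Let $s$ be the antipode of $H^*$, so $\langle s(p),h\rangle=\langle p,S(h)\rangle$; products in $H^*$ are convolution products, $\langle pq,h\rangle=\sum\langle p,h_1\rangle\langle q,h_2\rangle$. Let $V_0,\dots,V_{n-1}$ be a complete set of pairwise non-isomorphic irreducible $H$-modules, with $V_0$ the trivial module (on which $h\in H$ acts as $\varepsilon(h)$). For $0\le i\le n-1$ let $\chi_i\in H^*$ be the character of $V_i$ (so $\chi_0=\varepsilon$), let $d_i=\dim_k V_i$, and let $E_i$ be the primitive idempotent of the center $Z(H)$ that acts on $V_i$ as the identity. For $a,b\in H$ put $$\{a,b\}=\sum a_1b_1S(a_2)S(b_2).$$ Then $\{z,\Lambda\}\in Z(H)$ for every $z\in Z(H)$, so that $T(z)=\{z,\Lambda\}$ is a linear operator on $Z(H)$, and the following hold. (i) The elements $\frac{E_0}{d_0^2},\dots,\frac{E_{n-1}}{d_{n-1}^2}$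 form a basis of $Z(H)$, and the matrix of $T$ with respect to it is $A=(A_{ij})_{0\le i,j\le n-1}$, where $$A_{ij}=\frac{\langle\chi_i\,s(\chi_i)\,s(\chi_j),\Lambda\rangle}{d_j},\qquad\text{that is,}\qquad T\Big(\frac{E_j}{d_j^2}\Big)=\sum_i A_{ij}\frac{E_i}{d_i^2}.$$ (ii) All entries of $A$ are non-negative rational numbers, and all entries of the first column of $A$ (column $0$) are equal to $1$. (iii) For all $m\ge 0$, the first row of $A^m$ (row $0$) is $(1,0,\dots,0)$. (iv) For all $m>0$ and $0\le i\le n-1$, $$(A^m)_{i0}=\sum_j (A^{m-1})_{ij}.$$ In particular, all entries of the first column of $A^m$ are positive rational numbers for every $m>0$. -/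

import Mathlib

open scoped TensorProduct
open Coalgebra HopfAlgebra Module

universe u v w

namespace HopfCommutator

noncomputable section

/-! ### Integrals -/

section Integral

variable (k : Type u) (H : Type v) [Field k] [Ring H] [HopfAlgebra k H]

/-- `x` is a (two-sided) integral of `H` with `ε(x) = 1`; such an `x` is idempotent. -/
structure IsIdempotentIntegral (x : H) : Prop where
  mul_left : ∀ h : H, h * x = (counit (R := k) h) • x
  mul_right : ∀ h : H, x * h = (counit (R := k) h) • x
  counit_eq_one : counit (R := k) x = 1

theorem existsUnique_idempotentIntegral [IsSemisimpleRing H] :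
    ∃! x : H, IsIdempotentIntegral k H x := by
  -- `I` is the left ideal of left integrals
  let I : Submodule H H :=
    { carrier := {x | ∀ h : H, h * x = (counit (R := k) h) • x}
      add_mem' := by
        intro a b ha hb h
        rw [mul_add, ha h, hb h, smul_add]
      zero_mem' := by intro h; simp
      smul_mem' := by
        intro c x hx h
        have h1 := hx (h * c)
        have h2 := hx c
        rw [smul_eq_mul, ← mul_assoc, h1, h2, Bialgebra.counit_mul, mul_smul] }
  have hI : ∀ x, x ∈ I ↔ ∀ h : H, h * x = (counit (R := k) h) • x := fun x => Iff.rfl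
  -- a left integral of counit one, from a complement of the augmentation ideal
  let K : Submodule H H :=
    { carrier := {x | counit (R := k) x = 0}
      add_mem' := by intro a b ha hb; simp_all
      zero_mem' := by simp
      smul_mem' := by intro c x hx; simp_all }
  have hK : ∀ x, x ∈ K ↔ counit (R := k) x = 0 := fun x => Iff.rfl
  obtain ⟨J, hJ⟩ := exists_isCompl K
  have h1 : (1 : H) ∈ K ⊔ J := by rw [hJ.sup_eq_top]; trivial
  obtain ⟨a, ha, t, ht, hat⟩ := Submodule.mem_sup.1 h1
  have ht1 : counit (R := k) t = 1 := by
    have := congrArg (counit (R := k)) hat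
    rw [map_add, (hK a).1 ha, zero_add, Bialgebra.counit_one] at this
    exact this
  have htI : ∀ h : H, h * t = (counit (R := k) h) • t := by
    intro h
    have hm : h * t - (counit (R := k) h) • t ∈ K ⊓ J := by
      refine ⟨?_, ?_⟩
      · rw [SetLike.mem_coe, hK, map_sub, Bialgebra.counit_mul, map_smul, smul_eq_mul, sub_self]
      · have : h * t - (counit (R := k) h) • t
            = (h - algebraMap k H (counit (R := k) h)) • t := by
          rw [smul_eq_mul, sub_mul, Algebra.smul_def]
        rw [SetLike.mem_coe, this]
        exact J.smul_mem _ ht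
    rw [hJ.inf_eq_bot, Submodule.mem_bot] at hm
    exact sub_eq_zero.1 hm
  -- `I` is a right ideal as well, so it has a right identity `e`
  obtain ⟨L, hL⟩ := exists_isCompl I
  have h2 : (1 : H) ∈ I ⊔ L := by rw [hL.sup_eq_top]; trivial
  obtain ⟨e, he, f, hf, hef⟩ := Submodule.mem_sup.1 h2
  have hxe : ∀ x ∈ I, x = (counit (R := k) x) • e := by
    intro x hx
    have hxf : x * f ∈ I ⊓ L := by
      refine ⟨?_, L.smul_mem x hf⟩
      rw [SetLike.mem_coe, hI]
      intro h
      rw [← mul_assoc, (hI x).1 hx h, smul_mul_assoc]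
    rw [hL.inf_eq_bot, Submodule.mem_bot] at hxf
    have : x = x * e + x * f := by rw [← mul_add, hef, mul_one]
    rw [hxf, add_zero, (hI e).1 he x] at this
    exact this
  have hte : t = e := by
    have := hxe t htI
    rwa [ht1, one_smul] at this
  subst hte
  refine ⟨t, ⟨htI, ?_, ht1⟩, ?_⟩
  · intro h
    have hm : t * h ∈ I := by
      rw [hI]
      intro g
      rw [← mul_assoc, htI g, smul_mul_assoc]
    rw [hxe _ hm, Bialgebra.counit_mul, ht1, one_mul]
  · intro y hy
    have := hxe y hy.mul_left
    rwa [hy.counit_eq_one, one_smul] at this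

/-- The idempotent integral `Λ` of a semisimple Hopf algebra. -/
def idempotentIntegral [IsSemisimpleRing H] : H :=
  (existsUnique_idempotentIntegral k H).choose

end Integral

/-! ### The generalized commutator -/

section Commutator

variable (k : Type u) (H : Type v) [Field k] [Ring H] [HopfAlgebra k H]

/-- `a ↦ ∑ a₁ ⊗ S a₂`. -/
def comulAntipode : H →ₗ[k] H ⊗[k] H :=
  (antipode k).lTensor H ∘ₗ comul

/-- The generalized commutator `{a, b} = ∑ a₁ b₁ (S a₂) (S b₂)`, bilinear in `a` and `b`. -/
def genCommutator : H →ₗ[k] H →ₗ[k] H :=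
  ((LinearMap.mul k (H ⊗[k] H)).compl₁₂ (comulAntipode k H) (comulAntipode k H)).compr₂
    (LinearMap.mul' k H)

theorem genCommutator_apply {ι κ : Type*} {a b : H} (ra : Coalgebra.Repr k a ι)
    (rb : Coalgebra.Repr k b κ) :
    genCommutator k H a b = ∑ i ∈ ra.index, ∑ j ∈ rb.index,
      ra.left i * rb.left j * antipode k (ra.right i) * antipode k (rb.right j) := by
  simp [genCommutator, comulAntipode, ← ra.eq, ← rb.eq, map_sum, mul_assoc]
  exact Finset.sum_comm

end Commutator

/-! ### Irreducible modules, characters and central primitive idempotents -/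

section Modules

/-- `e` is a primitive idempotent of the center of `R`. -/
structure IsCentralPrimitiveIdempotent {R : Type v} [Ring R] (e : R) : Prop where
  mem_center : e ∈ Subring.center R
  isIdempotentElem : IsIdempotentElem e
  ne_zero : e ≠ 0
  primitive : ∀ g ∈ Subring.center R, IsIdempotentElem g → g * e = g → g = 0 ∨ g = e

theorem existsUnique_centralIdempotent (R : Type v) [Ring R] [IsSemisimpleRing R]
    (V : Type w) [AddCommGroup V] [Module R V] [IsSimpleModule R V] :
    ∃! e : R, IsCentralPrimitiveIdempotent e ∧ ∀ x : V, e • x = x := by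
  have hnt : Nontrivial V := IsSimpleModule.nontrivial R V
  obtain ⟨v₀, hv₀⟩ := exists_ne (0 : V)
  -- the annihilator of `V` as a left ideal
  let N : Submodule R R :=
    { carrier := {r | ∀ x : V, r • x = 0}
      add_mem' := by intro a b ha hb x; rw [add_smul, ha x, hb x, add_zero]
      zero_mem' := by intro x; simp
      smul_mem' := by intro c r hr x; rw [smul_eq_mul, mul_smul, hr x, smul_zero] }
  have hN : ∀ r, r ∈ N ↔ ∀ x : V, r • x = 0 := fun r => Iff.rfl
  have hNr : ∀ r ∈ N, ∀ s, r * s ∈ N := by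
    intro r hr s
    rw [hN]
    intro x
    rw [mul_smul]
    exact hr _
  obtain ⟨J, hJ⟩ := exists_isCompl N
  have h1 : (1 : R) ∈ N ⊔ J := by rw [hJ.sup_eq_top]; trivial
  obtain ⟨f, hf, e, he, hfe⟩ := Submodule.mem_sup.1 h1
  have hxe : ∀ r ∈ N, r * e = 0 := by
    intro r hr
    have : r * e ∈ N ⊓ J := ⟨hNr r hr e, J.smul_mem r he⟩
    rwa [hJ.inf_eq_bot, Submodule.mem_bot] at this
  have hxf : ∀ r ∈ N, r * f = r := by
    intro r hr
    have : r = r * f + r * e := by rw [← mul_add, hfe, mul_one]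
    rw [hxe r hr, add_zero] at this
    exact this.symm
  have hex : ∀ r ∈ N, e * r = 0 := by
    intro r hr
    have hy : ∀ s, (e * r) * s * (e * r) = 0 := by
      intro s
      have : (r * s) * e = 0 := hxe _ (hNr r hr s)
      calc (e * r) * s * (e * r) = e * ((r * s) * e) * r := by simp only [mul_assoc]
        _ = 0 := by rw [this]; simp
    obtain ⟨L, hL⟩ := exists_isCompl (Submodule.span R {e * r})
    have h2 : (1 : R) ∈ Submodule.span R {e * r} ⊔ L := by rw [hL.sup_eq_top]; trivial
    obtain ⟨a, ha, b, hb, hab⟩ := Submodule.mem_sup.1 h2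
    obtain ⟨c, rfl⟩ := Submodule.mem_span_singleton.1 ha
    have h3 : (e * r) * (c • (e * r)) = 0 := by
      rw [smul_eq_mul, ← mul_assoc]
      exact hy c
    have h4 : e * r = (e * r) * b := by
      have := congrArg (fun z => (e * r) * z) hab
      simp only [mul_add, h3, zero_add, mul_one] at this
      exact this.symm
    have h5 : e * r ∈ Submodule.span R {e * r} ⊓ L :=
      ⟨Submodule.mem_span_singleton_self _, by
        rw [SetLike.mem_coe, h4]; exact L.smul_mem _ hb⟩
    rwa [hL.inf_eq_bot, Submodule.mem_bot] at h5
  have hfx : ∀ r ∈ N, f * r = r := by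
    intro r hr
    have : r = f * r + e * r := by rw [← add_mul, hfe, one_mul]
    rw [hex r hr, add_zero] at this
    exact this.symm
  have hfc : ∀ s, s * f = f * s := by
    intro s
    rw [← hfx (s * f) (N.smul_mem s hf), ← mul_assoc, hxf (f * s) (hNr f hf s)]
  have he1 : e = 1 - f := by rw [← hfe]; abel
  have hec : e ∈ Subring.center R := by
    rw [Subring.mem_center_iff]
    intro s
    rw [he1, mul_sub, sub_mul, hfc s, one_mul, mul_one]
  have hev : ∀ x : V, e • x = x := by
    intro x
    rw [he1, sub_smul, one_smul, (hN f).1 hf x, sub_zero]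
  have hprim : IsCentralPrimitiveIdempotent e := by
    refine ⟨hec, ?_, ?_, ?_⟩
    · have h6 : (f + e) * e = e := by rw [hfe, one_mul]
      rwa [add_mul, hxe f hf, zero_add] at h6
    · intro h
      apply hv₀
      rw [← hev v₀, h, zero_smul]
    · intro g hg hgi hge
      rw [Subring.mem_center_iff] at hg
      let W : Submodule R V :=
        { carrier := {x | g • x = 0}
          add_mem' := by intro a b ha hb; simp_all
          zero_mem' := by simp
          smul_mem' := by
            intro c x hx
            change g • x = 0 at hx
            change g • c • x = 0
            rw [← mul_smul, ← hg c, mul_smul, hx, smul_zero] }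
      have hW : ∀ x, x ∈ W ↔ g • x = 0 := fun x => Iff.rfl
      rcases eq_bot_or_eq_top W with hb | ht
      · right
        have hm : 1 - g ∈ N := by
          rw [hN]
          intro x
          have : (1 - g) • x ∈ W := by
            rw [hW, ← mul_smul, mul_sub, mul_one, hgi.eq, sub_self, zero_smul]
          rwa [hb, Submodule.mem_bot] at this
        have := hxe _ hm
        rw [sub_mul, one_mul, hge, sub_eq_zero] at this
        exact this.symm
      · left
        have hm : g ∈ N := by
          rw [hN]
          intro x
          have : x ∈ W := by rw [ht]; trivial
          exact (hW x).1 this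
        rw [← hge, hxe g hm]
  refine ⟨e, ⟨hprim, hev⟩, ?_⟩
  rintro e' ⟨hp, hv⟩
  have hc := Subring.mem_center_iff.1 hec
  have hmem : e' * e ∈ Subring.center R := mul_mem hp.mem_center hec
  have hidem : IsIdempotentElem (e' * e) :=
    IsIdempotentElem.mul_of_commute (hc e') hp.isIdempotentElem hprim.isIdempotentElem
  have hne : e' * e ≠ 0 := by
    intro h
    apply hv₀
    rw [← hv v₀, ← hev v₀, ← mul_smul, h, zero_smul]
  have hA := (hprim.primitive _ hmem hidem
    (by rw [mul_assoc, hprim.isIdempotentElem.eq])).resolve_left hne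
  have hB := (hp.primitive _ hmem hidem
    (by rw [hc e', mul_assoc, hp.isIdempotentElem.eq])).resolve_left hne
  rw [← hA, hB]

/-- The central primitive idempotent associated with the irreducible module `V`: the one that acts
on `V` as the identity. -/
def centralIdempotent (R : Type v) [Ring R] [IsSemisimpleRing R]
    (V : Type w) [AddCommGroup V] [Module R V] [IsSimpleModule R V] : R :=
  (existsUnique_centralIdempotent R V).choose

/-- The family `V` of irreducible left `R`-modules is a complete set of pairwise non-isomorphic irreducible modules. (Every
irreducible module is isomorphic to a quotient of `R`, so the universe of `R` is large enough in
the last clause.) -/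
structure IsCompleteSetOfIrreducibles (R : Type v) [Ring R] {ι : Type*} (V : ι → Type w)
    [∀ i, AddCommGroup (V i)] [∀ i, Module R (V i)] [∀ i, IsSimpleModule R (V i)] : Prop where
  pairwise_not_iso : ∀ i j, Nonempty (V i ≃ₗ[R] V j) → i = j
  complete : ∀ (M : Type v) [AddCommGroup M] [Module R M] [IsSimpleModule R M],
    ∃ i, Nonempty (M ≃ₗ[R] V i)

variable (k : Type u) (H : Type v) [Field k] [Ring H] [HopfAlgebra k H]

/-- The character of the module `V`, as an element of `H^*`, which is an algebra under the
convolution product `⟨p q, h⟩ = ∑ ⟨p, h₁⟩ ⟨q, h₂⟩`. -/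
def character (V : Type w) [AddCommGroup V] [Module k V] [Module H V] [IsScalarTower k H V] :
    WithConv (H →ₗ[k] k) :=
  WithConv.toConv (LinearMap.trace k V ∘ₗ (Algebra.lsmul k k V : H →ₐ[k] End k V).toLinearMap)

/-- The antipode `s` of `H^*`: `⟨s(p), h⟩ = ⟨p, S h⟩`. -/
def dualAntipode (p : WithConv (H →ₗ[k] k)) : WithConv (H →ₗ[k] k) :=
  WithConv.toConv (p.ofConv ∘ₗ antipode k)

/-- The commutator matrix `A i j = ⟨χ_i s(χ_i) s(χ_j), Λ⟩ / d_j`, where `χ_i` is the character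
of `V i` and `d_i` is its dimension. -/
def commutatorMatrix [IsSemisimpleRing H] {ι : Type*} (V : ι → Type w) [∀ i, AddCommGroup (V i)]
    [∀ i, Module k (V i)] [∀ i, Module H (V i)] [∀ i, IsScalarTower k H (V i)] : Matrix ι ι k :=
  Matrix.of fun i j =>
    (character k H (V i) * dualAntipode k H (character k H (V i)) *
      dualAntipode k H (character k H (V j))).ofConv (idempotentIntegral k H) /
        (finrank k (V j) : k)

end Modules

end

end HopfCommutator

/-! Everything about `T` follows from Schur's lemma once S² = id is known. Write ρ_i for the action
on V_i. Averaging an endomorphism f of V_i gives Σ ρ_i(Λ₁) f ρ_i(S Λ₂) = (tr f / d_i)·1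
(`average_eq`). Taking traces of averages yields orthogonality of characters and hence E_j = d_j Σ
Λ₁ χ_j(S Λ₂) (`centralIdempotent_eq`). Averaging f = ρ_i(S z₂) shows that {z, Λ} acts on V_i as
d_i⁻¹ Σ z₁ χ_i(S z₂). For z = E_j the two slices compose into the slice of Λ by s(χ_i) s(χ_j), a
trace function, so the result is central and its scalar on V_i is the matrix entry after rescaling.
The numerator of A_ij is the trace of the idempotent Λ on V_i ⊗ V_i* ⊗ V_j*, a natural number.
Orthogonality makes column 0 all ones and row 0 a unit vector; the claims on powers are then formal.

The bulk of the work is S² = id (Larson–Radford). Slicing Δ(Λ) identifies H* with H, which produces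
a right integral l and a left integral m of H*. These are Frobenius forms whose Nakayama
automorphisms are S² and its inverse, and tr(S²) = l(1).

To see l(1) ≠ 0, write l = χ(w·) with χ = Σ χ_i, so that S² is conjugation by w. Computing the trace
of f ↦ ρ_i(w⁻¹) f in two ways gives tr ρ_i(w⁻¹) = 1, so l(1) = Σ tr ρ_i(w) tr ρ_i(w⁻¹). Radford's
formula makes a power of w central, so each summand becomes a squared absolute value after embedding
algebraic numbers into ℂ, and the trivial module contributes 1.

If l(1) ≠ 0, then l = m and S⁴ = id. Comparing tr(S²) with the trace of S² on the image of the
projection defined by the regular character shows that tr(S²) is a nonzero multiple of dim H, which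
forces S² = ±id; the sign is fixed by S²(1) = 1. -/

namespace HopfCommutator

noncomputable section

/-! ### Convolution, slices of the comultiplication, and the antipode -/

section Convolution

open WithConv

variable {k : Type u} {H : Type v} [Field k] [Ring H] [HopfAlgebra k H]

/-- A functional viewed as a map to the algebra `A` with values in the scalars. -/
def scalarConv (A : Type*) [Ring A] [Algebra k A] (p : H →ₗ[k] k) : WithConv (H →ₗ[k] A) :=
  toConv (Algebra.linearMap k A ∘ₗ p)

theorem scalarConv_apply (A : Type*) [Ring A] [Algebra k A] (p : H →ₗ[k] k) (x : H) :
    (scalarConv A p).ofConv x = algebraMap k A (p x) := rfl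

theorem scalarConv_mul (A : Type*) [Ring A] [Algebra k A] (p q : WithConv (H →ₗ[k] k)) :
    scalarConv A (p * q).ofConv = scalarConv A p.ofConv * scalarConv A q.ofConv := by
  apply WithConv.ext
  exact LinearMap.algHom_comp_convMul_distrib (Algebra.ofId k A) p q

/-- `x ↦ ∑ p(x₁) x₂` -/
def leftSlice (p : H →ₗ[k] k) : H →ₗ[k] H := (scalarConv H p * toConv LinearMap.id).ofConv

/-- `x ↦ ∑ x₁ p(x₂)` -/
def rightSlice (p : H →ₗ[k] k) : H →ₗ[k] H := (toConv LinearMap.id * scalarConv H p).ofConv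

theorem conv_apply {A : Type*} [Ring A] [Algebra k A] (f g : WithConv (H →ₗ[k] A)) {x : H}
    {ι : Type*} (r : Coalgebra.Repr k x ι) :
    (f * g).ofConv x = ∑ i ∈ r.index, f.ofConv (r.left i) * g.ofConv (r.right i) :=
  r.convMul_apply f g

theorem leftSlice_apply (p : H →ₗ[k] k) {x : H} {ι : Type*} (r : Coalgebra.Repr k x ι) :
    leftSlice p x = ∑ i ∈ r.index, p (r.left i) • r.right i := by
  simp [leftSlice, conv_apply _ _ r, scalarConv_apply, Algebra.smul_def]

theorem rightSlice_apply (p : H →ₗ[k] k) {x : H} {ι : Type*} (r : Coalgebra.Repr k x ι) :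
    rightSlice p x = ∑ i ∈ r.index, p (r.right i) • r.left i := by
  simp [rightSlice, conv_apply _ _ r, scalarConv_apply, Algebra.smul_def, Algebra.commutes]

theorem scalarConv_mul_toConv {A : Type*} [Ring A] [Algebra k A] (p : H →ₗ[k] k) (f : H →ₗ[k] A) :
    scalarConv A p * toConv f = toConv (f ∘ₗ leftSlice p) := by
  apply WithConv.ext
  ext x
  simp [conv_apply _ _ (ℛ k x), scalarConv_apply, leftSlice_apply _ (ℛ k x), ← Algebra.smul_def]

theorem toConv_mul_scalarConv {A : Type*} [Ring A] [Algebra k A] (p : H →ₗ[k] k) (f : H →ₗ[k] A) :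
    toConv f * scalarConv A p = toConv (f ∘ₗ rightSlice p) := by
  apply WithConv.ext
  ext x
  simp [conv_apply _ _ (ℛ k x), scalarConv_apply, rightSlice_apply _ (ℛ k x), ← Algebra.commutes,
    ← Algebra.smul_def]

/-- Coassociativity. Left slices reverse the order of a convolution product; right slices preserve
it. -/
theorem leftSlice_mul (p q : WithConv (H →ₗ[k] k)) :
    leftSlice (p * q).ofConv = leftSlice q.ofConv ∘ₗ leftSlice p.ofConv := by
  rw [leftSlice, scalarConv_mul, mul_assoc]
  exact congrArg WithConv.ofConv (scalarConv_mul_toConv p.ofConv (leftSlice q.ofConv))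

theorem rightSlice_mul (p q : WithConv (H →ₗ[k] k)) :
    rightSlice (p * q).ofConv = rightSlice p.ofConv ∘ₗ rightSlice q.ofConv := by
  rw [rightSlice, scalarConv_mul, ← mul_assoc]
  exact congrArg WithConv.ofConv (toConv_mul_scalarConv q.ofConv (rightSlice p.ofConv))

theorem conv_eq_leftSlice (p q : WithConv (H →ₗ[k] k)) (x : H) :
    (p * q).ofConv x = q.ofConv (leftSlice p.ofConv x) := by
  simp [conv_apply _ _ (ℛ k x), leftSlice_apply _ (ℛ k x)]

theorem conv_eq_rightSlice (p q : WithConv (H →ₗ[k] k)) (x : H) :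
    (p * q).ofConv x = p.ofConv (rightSlice q.ofConv x) := by
  simp [conv_apply _ _ (ℛ k x), rightSlice_apply _ (ℛ k x), mul_comm]

theorem leftSlice_one (p : H →ₗ[k] k) : leftSlice p 1 = p 1 • 1 := by
  have h : (comul (R := k) (1 : H)) = 1 ⊗ₜ 1 := Bialgebra.comul_one
  simp [leftSlice, LinearMap.convMul_def, h, scalarConv_apply, Algebra.smul_def]

theorem rightSlice_one (p : H →ₗ[k] k) : rightSlice p 1 = p 1 • 1 := by
  have h : (comul (R := k) (1 : H)) = 1 ⊗ₜ 1 := Bialgebra.comul_one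
  simp [rightSlice, LinearMap.convMul_def, h, scalarConv_apply, Algebra.smul_def]

theorem counit_leftSlice (p : H →ₗ[k] k) (x : H) :
    counit (R := k) (leftSlice p x) = p x := by
  have h := conv_eq_leftSlice (toConv p) (toConv (counit (R := k) (A := H))) x
  have h1 : toConv (counit (R := k) (A := H)) = (1 : WithConv (H →ₗ[k] k)) := rfl
  rw [h1, mul_one] at h
  exact h.symm

theorem counit_rightSlice (p : H →ₗ[k] k) (x : H) :
    counit (R := k) (rightSlice p x) = p x := by
  have h := conv_eq_rightSlice (toConv (counit (R := k) (A := H))) (toConv p) x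
  have h1 : toConv (counit (R := k) (A := H)) = (1 : WithConv (H →ₗ[k] k)) := rfl
  rw [h1, one_mul] at h
  exact h.symm

theorem includeLeft_conv_includeRight :
    (toConv (Algebra.TensorProduct.includeLeft : H →ₐ[k] H ⊗[k] H).toLinearMap *
      toConv (Algebra.TensorProduct.includeRight : H →ₐ[k] H ⊗[k] H).toLinearMap) =
      toConv (comul : H →ₗ[k] H ⊗[k] H) := by
  apply WithConv.ext
  ext x
  rw [conv_apply _ _ (ℛ k x)]
  conv_rhs => rw [← (ℛ k x).eq]
  simp

theorem algHom_conv_antipode {A : Type*} [Ring A] [Algebra k A] (f : H →ₐ[k] A) :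
    toConv f.toLinearMap * toConv (f.toLinearMap ∘ₗ antipode k) = 1 := by
  apply WithConv.ext
  have h := LinearMap.algHom_comp_convMul_distrib f (toConv LinearMap.id) (toConv (antipode k (A := H)))
  rw [LinearMap.id_mul_antipode] at h
  refine Eq.trans h.symm ?_
  ext x
  simp

theorem antipode_conv_algHom {A : Type*} [Ring A] [Algebra k A] (f : H →ₐ[k] A) :
    toConv (f.toLinearMap ∘ₗ antipode k) * toConv f.toLinearMap = 1 := by
  apply WithConv.ext
  have h := LinearMap.algHom_comp_convMul_distrib f (toConv (antipode k (A := H))) (toConv LinearMap.id)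
  rw [LinearMap.antipode_mul_id] at h
  refine Eq.trans h.symm ?_
  ext x
  simp

theorem mulLeft_comp_conv {A : Type*} [Ring A] [Algebra k A] (c : A) (f g : WithConv (H →ₗ[k] A)) :
    toConv (LinearMap.mulLeft k c ∘ₗ (f * g).ofConv) =
      toConv (LinearMap.mulLeft k c ∘ₗ f.ofConv) * g := by
  apply WithConv.ext
  ext x
  simp [conv_apply _ _ (ℛ k x), mul_assoc]

theorem mulRight_comp_conv {A : Type*} [Ring A] [Algebra k A] (c : A) (f g : WithConv (H →ₗ[k] A)) :
    toConv (LinearMap.mulRight k c ∘ₗ (f * g).ofConv) =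
      f * toConv (LinearMap.mulRight k c ∘ₗ g.ofConv) := by
  apply WithConv.ext
  ext x
  simp [conv_apply _ _ (ℛ k x), mul_assoc]

/-- The antipode is an anti-homomorphism of coalgebras. -/
theorem comul_comp_antipode :
    toConv ((comul : H →ₗ[k] H ⊗[k] H) ∘ₗ antipode k) =
      toConv ((Algebra.TensorProduct.includeRight : H →ₐ[k] H ⊗[k] H).toLinearMap ∘ₗ antipode k) *
      toConv ((Algebra.TensorProduct.includeLeft : H →ₐ[k] H ⊗[k] H).toLinearMap ∘ₗ antipode k) := by
  refine (left_inv_eq_right_inv (a := toConv (comul : H →ₗ[k] H ⊗[k] H)) ?_ ?_).symm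
  · rw [← includeLeft_conv_includeRight, mul_assoc,
      ← mul_assoc (toConv ((Algebra.TensorProduct.includeLeft : H →ₐ[k] H ⊗[k] H).toLinearMap ∘ₗ
        antipode k)),
      antipode_conv_algHom, one_mul, antipode_conv_algHom]
  · exact LinearMap.comul_right_inv

theorem comul_antipode {x : H} {ι : Type*} (r : Coalgebra.Repr k x ι) :
    comul (R := k) (antipode k x) =
      ∑ i ∈ r.index, antipode k (r.right i) ⊗ₜ[k] antipode k (r.left i) := by
  have h := congrArg (fun f => f.ofConv x) (comul_comp_antipode (k := k) (H := H))
  simp only [conv_apply _ _ r] at h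
  simpa using h

end Convolution

/-! ### Casimir identities for Δ(Λ) -/

section Casimir

variable {k : Type u} {H : Type v} [Field k] [Ring H] [HopfAlgebra k H]
  {Λ : H} (hΛ : IsIdempotentIntegral k H Λ)

include hΛ

open WithConv

/-- Δ(h)Δ(Λ) = ε(h)Δ(Λ), and convolving with S ⊗ 1 on the left cancels the first leg of Δ(h). -/
theorem IsIdempotentIntegral.casimir_left (h : H) :
    (antipode k h ⊗ₜ[k] 1) * comul (R := k) Λ = (1 ⊗ₜ[k] h) * comul (R := k) Λ := by
  let i₁ := (Algebra.TensorProduct.includeLeft : H →ₐ[k] H ⊗[k] H)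
  let i₂ := (Algebra.TensorProduct.includeRight : H →ₐ[k] H ⊗[k] H)
  have h1 : toConv (i₁.toLinearMap ∘ₗ antipode k) * toConv (comul : H →ₗ[k] H ⊗[k] H) =
      toConv i₂.toLinearMap := by
    rw [← includeLeft_conv_includeRight, ← mul_assoc, antipode_conv_algHom, one_mul]
  have h2 := mulRight_comp_conv (comul (R := k) Λ) (toConv (i₁.toLinearMap ∘ₗ antipode k))
    (toConv (comul : H →ₗ[k] H ⊗[k] H))
  have h3 : LinearMap.mulRight k (comul (R := k) Λ) ∘ₗ (comul : H →ₗ[k] H ⊗[k] H) =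
      LinearMap.mulRight k (comul (R := k) Λ) ∘ₗ (1 : WithConv (H →ₗ[k] H ⊗[k] H)).ofConv := by
    ext x
    change comul (R := k) x * comul (R := k) Λ =
      algebraMap k (H ⊗[k] H) (counit (R := k) x) * comul (R := k) Λ
    rw [← Bialgebra.comul_mul, hΛ.mul_left, map_smul, Algebra.smul_def]
  rw [h1, ofConv_toConv, ofConv_toConv, h3, ← mulRight_comp_conv, mul_one] at h2
  exact (congrArg (fun f => f.ofConv h) h2).symm

theorem IsIdempotentIntegral.casimir_right (h : H) :
    comul (R := k) Λ * (h ⊗ₜ[k] 1) = comul (R := k) Λ * (1 ⊗ₜ[k] antipode k h) := by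
  let i₁ := (Algebra.TensorProduct.includeLeft : H →ₐ[k] H ⊗[k] H)
  let i₂ := (Algebra.TensorProduct.includeRight : H →ₐ[k] H ⊗[k] H)
  have h1 : toConv (comul : H →ₗ[k] H ⊗[k] H) * toConv (i₂.toLinearMap ∘ₗ antipode k) =
      toConv i₁.toLinearMap := by
    rw [← includeLeft_conv_includeRight, mul_assoc, algHom_conv_antipode, mul_one]
  have h2 := mulLeft_comp_conv (comul (R := k) Λ) (toConv (comul : H →ₗ[k] H ⊗[k] H))
    (toConv (i₂.toLinearMap ∘ₗ antipode k))
  have h3 : LinearMap.mulLeft k (comul (R := k) Λ) ∘ₗ (comul : H →ₗ[k] H ⊗[k] H) =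
      LinearMap.mulLeft k (comul (R := k) Λ) ∘ₗ (1 : WithConv (H →ₗ[k] H ⊗[k] H)).ofConv := by
    ext x
    change comul (R := k) Λ * comul (R := k) x =
      comul (R := k) Λ * algebraMap k (H ⊗[k] H) (counit (R := k) x)
    rw [← Bialgebra.comul_mul, hΛ.mul_right, map_smul, ← Algebra.commutes, Algebra.smul_def]
  rw [h1, ofConv_toConv, ofConv_toConv, h3, ← mulLeft_comp_conv, one_mul] at h2
  exact congrArg (fun f => f.ofConv h) h2

theorem IsIdempotentIntegral.sum_casimir_left {ι : Type*} (r : Coalgebra.Repr k Λ ι)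
    {M : Type*} [AddCommGroup M] [Module k M] (B : H →ₗ[k] H →ₗ[k] M) (h : H) :
    ∑ i ∈ r.index, B (antipode k h * r.left i) (r.right i) =
      ∑ i ∈ r.index, B (r.left i) (h * r.right i) := by
  have := congrArg (TensorProduct.lift B) (hΛ.casimir_left h)
  simpa [← r.eq, Finset.mul_sum] using this

theorem IsIdempotentIntegral.sum_casimir_right {ι : Type*} (r : Coalgebra.Repr k Λ ι)
    {M : Type*} [AddCommGroup M] [Module k M] (B : H →ₗ[k] H →ₗ[k] M) (h : H) :
    ∑ i ∈ r.index, B (r.left i * h) (r.right i) =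
      ∑ i ∈ r.index, B (r.left i) (r.right i * antipode k h) := by
  have := congrArg (TensorProduct.lift B) (hΛ.casimir_right h)
  simpa [← r.eq, Finset.sum_mul] using this

theorem IsIdempotentIntegral.sum_antipode_mul {ι : Type*} (r : Coalgebra.Repr k Λ ι) :
    ∑ i ∈ r.index, antipode k (r.left i) * r.right i = 1 := by
  rw [sum_antipode_mul_eq_algebraMap_counit r, hΛ.counit_eq_one, map_one]

theorem IsIdempotentIntegral.sum_mul_antipode {ι : Type*} (r : Coalgebra.Repr k Λ ι) :
    ∑ i ∈ r.index, r.left i * antipode k (r.right i) = 1 := by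
  rw [sum_mul_antipode_eq_algebraMap_counit r, hΛ.counit_eq_one, map_one]

/-- A Hopf algebra with an integral of counit one is finite-dimensional. -/
theorem IsIdempotentIntegral.finite : Module.Finite k H := by
  classical
  let β := Module.Free.chooseBasis k H
  obtain ⟨c, hc⟩ := TensorProduct.eq_repr_basis_left β (comul (R := k) Λ)
  let r : Coalgebra.Repr k Λ _ := ⟨c.support, β, c, hc⟩
  let W : Submodule k H := Submodule.span k (c.support.image c)
  have hcW : ∀ m ∈ c.support, c m ∈ W := fun m hm =>
    Submodule.subset_span (Finset.mem_coe.2 (Finset.mem_image_of_mem _ hm))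
  -- W, spanned by the right legs of Δ(Λ), is a left ideal: the Casimir identity moves h onto the
  -- left leg, and the coordinate at m isolates c m.
  have hmul : ∀ h, ∀ m ∈ c.support, h * c m ∈ W := by
    intro h m hm
    have h1 := hΛ.sum_casimir_left r ((LinearMap.lsmul k H).comp (β.coord m)) h
    have h2 : ∑ i ∈ r.index, (LinearMap.lsmul k H).comp (β.coord m) (r.left i) (h * r.right i) =
        h * c m := by
      rw [Finset.sum_eq_single m]
      · simp [r]
      · intro b _ hb
        simp [r, Finsupp.single_eq_of_ne, Ne.symm hb]
      · intro h3
        exact absurd hm h3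
    rw [← h2, ← h1]
    exact Submodule.sum_mem _ fun i hi => Submodule.smul_mem _ _ (hcW i hi)
  -- The left ideal W contains 1 = Σ S(Λ₁)Λ₂.
  have hW : W = ⊤ := by
    rw [eq_top_iff]
    intro h _
    rw [← mul_one h, ← hΛ.sum_antipode_mul r, Finset.mul_sum]
    refine Submodule.sum_mem _ fun i hi => ?_
    rw [← mul_assoc]
    exact hmul _ i hi
  exact ⟨⟨_, hW⟩⟩

end Casimir

/-! ### Integrals of H*, Nakayama automorphisms and Radford's formula -/

section DualIntegral

open WithConv

variable {k : Type u} {H : Type v} [Field k] [Ring H] [HopfAlgebra k H]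
  {Λ : H} (hΛ : IsIdempotentIntegral k H Λ)

/-- `p ↦ ∑ p(x₁) x₂`, as a linear map in the functional `p`. -/
def leftSliceₗ (x : H) : (H →ₗ[k] k) →ₗ[k] H where
  toFun p := leftSlice p x
  map_add' p q := by
    simp [leftSlice_apply _ (ℛ k x), add_smul, Finset.sum_add_distrib]
  map_smul' c p := by
    simp [leftSlice_apply _ (ℛ k x), Finset.smul_sum, mul_smul]

/-- `p ↦ ∑ x₁ p(x₂)`, as a linear map in the functional `p`. -/
def rightSliceₗ (x : H) : (H →ₗ[k] k) →ₗ[k] H where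
  toFun p := rightSlice p x
  map_add' p q := by
    simp [rightSlice_apply _ (ℛ k x), add_smul, Finset.sum_add_distrib]
  map_smul' c p := by
    simp [rightSlice_apply _ (ℛ k x), Finset.smul_sum, mul_smul]

theorem leftSlice_rightSlice_swap (p q : H →ₗ[k] k) (x : H) :
    q (leftSlice p x) = p (rightSlice q x) := by
  simp [leftSlice_apply _ (ℛ k x), rightSlice_apply _ (ℛ k x), mul_comm]

include hΛ

theorem IsIdempotentIntegral.leftSlice_mulLeft (p : H →ₗ[k] k) (h : H) :
    leftSlice (p ∘ₗ LinearMap.mulLeft k (antipode k h)) Λ = h * leftSlice p Λ := by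
  have := hΛ.sum_casimir_left (ℛ k Λ) ((LinearMap.lsmul k H).comp p) h
  simpa [leftSlice_apply _ (ℛ k Λ), Finset.mul_sum] using this

theorem IsIdempotentIntegral.leftSlice_mulRight (p : H →ₗ[k] k) (h : H) :
    leftSlice (p ∘ₗ LinearMap.mulRight k h) Λ = leftSlice p Λ * antipode k h := by
  have := hΛ.sum_casimir_right (ℛ k Λ) ((LinearMap.lsmul k H).comp p) h
  simpa [leftSlice_apply _ (ℛ k Λ), Finset.sum_mul] using this

theorem IsIdempotentIntegral.rightSlice_mulLeft (p : H →ₗ[k] k) (h : H) :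
    rightSlice (p ∘ₗ LinearMap.mulLeft k h) Λ = antipode k h * rightSlice p Λ := by
  have := hΛ.sum_casimir_left (ℛ k Λ) (((LinearMap.lsmul k H).comp p).flip) h
  simpa [rightSlice_apply _ (ℛ k Λ), Finset.mul_sum] using this.symm

theorem IsIdempotentIntegral.rightSlice_mulRight (p : H →ₗ[k] k) (h : H) :
    rightSlice (p ∘ₗ LinearMap.mulRight k (antipode k h)) Λ = rightSlice p Λ * h := by
  have := hΛ.sum_casimir_right (ℛ k Λ) (((LinearMap.lsmul k H).comp p).flip) h
  simpa [rightSlice_apply _ (ℛ k Λ), Finset.sum_mul] using this.symm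

/-- If the slice by p vanishes, so does Σ p(Λ₁y)Λ₂ for every y. Expanding Λ₂ in a basis inside y = Σ
Λ₁S(Λ₂)y then gives p(y) = 0. -/
theorem IsIdempotentIntegral.leftSliceₗ_injective :
    Function.Injective (leftSliceₗ (k := k) Λ) := by
  have := hΛ.finite
  rw [injective_iff_map_eq_zero]
  intro p hp
  have hp : leftSlice p Λ = 0 := hp
  let r := ℛ k Λ
  let β := Module.finBasis k H
  have h0 : ∀ y, ∑ i ∈ r.index, p (r.left i * y) • r.right i = 0 := by
    intro y
    have := hΛ.leftSlice_mulRight p y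
    rw [hp, zero_mul, leftSlice_apply _ r] at this
    exact this
  ext y
  have h1 : y = ∑ i ∈ r.index, ∑ m, β.repr (r.right i) m • (r.left i * (antipode k (β m) * y)) := by
    calc y = (∑ i ∈ r.index, r.left i * antipode k (r.right i)) * y := by
          rw [hΛ.sum_mul_antipode r, one_mul]
      _ = _ := by
          rw [Finset.sum_mul]
          refine Finset.sum_congr rfl fun i _ => ?_
          conv_lhs => rw [← β.sum_repr (r.right i)]
          simp only [map_sum, map_smul, Finset.mul_sum, Finset.sum_mul, mul_assoc, mul_smul_comm,
            smul_mul_assoc]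
  rw [h1, map_sum, Finset.sum_congr rfl fun i _ => map_sum _ _ _, Finset.sum_comm]
  simp only [map_smul, LinearMap.zero_apply]
  refine Finset.sum_eq_zero fun m _ => ?_
  have h2 := congrArg (fun z => β.repr z m) (h0 (antipode k (β m) * y))
  simpa [Finsupp.finsetSum_apply, mul_comm] using h2

theorem IsIdempotentIntegral.leftSliceₗ_bijective :
    Function.Bijective (leftSliceₗ (k := k) Λ) := by
  have := hΛ.finite
  exact ⟨hΛ.leftSliceₗ_injective, (LinearMap.injective_iff_surjective_of_finrank_eq_finrank
    Subspace.dual_finrank_eq).1 hΛ.leftSliceₗ_injective⟩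

theorem IsIdempotentIntegral.rightSliceₗ_bijective :
    Function.Bijective (rightSliceₗ (k := k) Λ) := by
  have := hΛ.finite
  have hinj : Function.Injective (rightSliceₗ (k := k) Λ) := by
    rw [injective_iff_map_eq_zero]
    intro p hp
    ext y
    obtain ⟨q, rfl⟩ := hΛ.leftSliceₗ_bijective.2 y
    have hp : rightSlice p Λ = 0 := hp
    change p (leftSlice q Λ) = 0
    rw [leftSlice_rightSlice_swap, hp, map_zero]
  exact ⟨hinj, (LinearMap.injective_iff_surjective_of_finrank_eq_finrank
    Subspace.dual_finrank_eq).1 hinj⟩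

theorem IsIdempotentIntegral.leftSlice_inj {p q : H →ₗ[k] k}
    (h : leftSlice p Λ = leftSlice q Λ) : p = q :=
  hΛ.leftSliceₗ_bijective.1 h

theorem IsIdempotentIntegral.rightSlice_inj {p q : H →ₗ[k] k}
    (h : rightSlice p Λ = rightSlice q Λ) : p = q :=
  hΛ.rightSliceₗ_bijective.1 h

theorem IsIdempotentIntegral.exists_leftSlice_eq_one : ∃ p : H →ₗ[k] k, leftSlice p Λ = 1 :=
  hΛ.leftSliceₗ_bijective.2 1

theorem IsIdempotentIntegral.exists_rightSlice_eq_one : ∃ p : H →ₗ[k] k, rightSlice p Λ = 1 :=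
  hΛ.rightSliceₗ_bijective.2 1

section

variable {l : H →ₗ[k] k} (hl : leftSlice l Λ = 1)
include hl

theorem IsIdempotentIntegral.leftSlice_mulLeft_antipode (h : H) :
    leftSlice (l ∘ₗ LinearMap.mulLeft k (antipode k h)) Λ = h := by
  rw [hΛ.leftSlice_mulLeft, hl, mul_one]

theorem IsIdempotentIntegral.leftSlice_comp_mulRight (h : H) :
    leftSlice (l ∘ₗ LinearMap.mulRight k h) Λ = antipode k h := by
  rw [hΛ.leftSlice_mulRight, hl, one_mul]

/-- Both functionals of x slice Δ(Λ) to S(h), and slicing is injective. -/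
theorem IsIdempotentIntegral.nakayama_left (h x : H) :
    l (antipode k (antipode k h) * x) = l (x * h) := by
  have := hΛ.leftSlice_inj ((hΛ.leftSlice_mulLeft_antipode hl (antipode k h)).trans
    (hΛ.leftSlice_comp_mulRight hl h).symm)
  exact LinearMap.congr_fun this x

theorem IsIdempotentIntegral.antipode_bijective : Function.Bijective (antipode k (A := H)) := by
  have := hΛ.finite
  have hinj : Function.Injective (antipode k (A := H)) := by
    rw [injective_iff_map_eq_zero]
    intro h hh
    rw [← hΛ.leftSlice_mulLeft_antipode hl h, hh]
    simp [leftSlice_apply _ (ℛ k Λ)]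
  exact ⟨hinj, LinearMap.injective_iff_surjective.1 hinj⟩

theorem IsIdempotentIntegral.nondegenerate {y : H} (hy : ∀ x, l (y * x) = 0) : y = 0 := by
  obtain ⟨h, rfl⟩ := (hΛ.antipode_bijective hl).2 y
  have h0 : l ∘ₗ LinearMap.mulLeft k (antipode k h) = 0 := LinearMap.ext hy
  have := hΛ.leftSlice_mulLeft_antipode hl h
  rw [h0] at this
  rw [← this]
  simp [leftSlice_apply _ (ℛ k Λ)]

theorem IsIdempotentIntegral.right_integral (p : WithConv (H →ₗ[k] k)) :
    toConv l * p = p.ofConv 1 • toConv l := by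
  apply WithConv.ext
  apply hΛ.leftSlice_inj
  have h1 : leftSlice (p.ofConv 1 • toConv l).ofConv Λ = p.ofConv 1 • leftSlice l Λ :=
    map_smul (leftSliceₗ Λ) _ _
  rw [h1, leftSlice_mul, LinearMap.comp_apply, ofConv_toConv, hl, leftSlice_one]

omit hΛ in
theorem apply_eq_one_of_leftSlice : l Λ = 1 := by
  rw [← counit_leftSlice, hl, Bialgebra.counit_one]

end

section

variable {m : H →ₗ[k] k} (hm : rightSlice m Λ = 1)
include hm

theorem IsIdempotentIntegral.nakayama_right (h x : H) :
    m (x * antipode k (antipode k h)) = m (h * x) := by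
  have h1 := hΛ.rightSlice_mulRight m (antipode k h)
  have h2 := hΛ.rightSlice_mulLeft m h
  rw [hm, one_mul] at h1
  rw [hm, mul_one] at h2
  exact LinearMap.congr_fun (hΛ.rightSlice_inj (h1.trans h2.symm)) x

theorem IsIdempotentIntegral.left_integral (p : WithConv (H →ₗ[k] k)) :
    p * toConv m = p.ofConv 1 • toConv m := by
  apply WithConv.ext
  apply hΛ.rightSlice_inj
  have h1 : rightSlice (p.ofConv 1 • toConv m).ofConv Λ = p.ofConv 1 • rightSlice m Λ :=
    map_smul (rightSliceₗ Λ) _ _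
  rw [h1, rightSlice_mul, LinearMap.comp_apply, ofConv_toConv, hm, rightSlice_one]

omit hΛ in
theorem apply_eq_one_of_rightSlice : m Λ = 1 := by
  rw [← counit_rightSlice, hm, Bialgebra.counit_one]

theorem IsIdempotentIntegral.left_integral_unique {n : WithConv (H →ₗ[k] k)}
    (hn : ∀ p : WithConv (H →ₗ[k] k), p * n = p.ofConv 1 • n) : n = n.ofConv Λ • toConv m := by
  apply WithConv.ext
  apply hΛ.rightSlice_inj
  have h1 : rightSlice (n.ofConv Λ • toConv m).ofConv Λ = n.ofConv Λ • rightSlice m Λ :=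
    map_smul (rightSliceₗ Λ) _ _
  rw [h1, hm, ← sub_eq_zero, ← Module.forall_dual_apply_eq_zero_iff k]
  intro q
  have h2 := congrArg (fun f => f.ofConv Λ) (hn (toConv q))
  have h3 : q (rightSlice n.ofConv Λ) = q 1 * n.ofConv Λ :=
    (conv_eq_rightSlice (toConv q) n Λ).symm.trans h2
  rw [map_sub, h3, map_smul, sub_eq_zero]
  exact mul_comm _ _

end

section

variable {l : H →ₗ[k] k} (hl : leftSlice l Λ = 1) {m : H →ₗ[k] k} (hm : rightSlice m Λ = 1)

include hm

/-- The product is again a left integral, hence a multiple of m, and evaluating at Λ gives the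
factor. The element `leftSlice m Λ` is the distinguished group-like element. -/
theorem IsIdempotentIntegral.left_integral_mul (p : WithConv (H →ₗ[k] k)) :
    toConv m * p = p.ofConv (leftSlice m Λ) • toConv m := by
  have h := hΛ.left_integral_unique hm (n := toConv m * p) fun q => by
    rw [← mul_assoc, hΛ.left_integral hm, smul_mul_assoc]
  rwa [conv_eq_leftSlice] at h

/-- Evaluation at this element is the eigenvalue of right multiplication on m, so it is
multiplicative on H*; this is group-likeness. -/
theorem IsIdempotentIntegral.isGroupLikeElem_leftSlice : IsGroupLikeElem k (leftSlice m Λ) := by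
  have := hΛ.finite
  have hm0 : m ≠ 0 := by
    rintro rfl
    simpa using apply_eq_one_of_rightSlice hm
  have hpq : ∀ p q : WithConv (H →ₗ[k] k), (p * q).ofConv (leftSlice m Λ) =
      p.ofConv (leftSlice m Λ) * q.ofConv (leftSlice m Λ) := by
    intro p q
    have h1 := hΛ.left_integral_mul hm (p * q)
    rw [← mul_assoc, hΛ.left_integral_mul hm, smul_mul_assoc, hΛ.left_integral_mul hm,
      smul_smul] at h1
    have h2 := congrArg (fun f => f.ofConv Λ) h1
    have h3 : m Λ = 1 := apply_eq_one_of_rightSlice hm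
    simpa [h3] using h2.symm
  constructor
  · rw [counit_leftSlice, apply_eq_one_of_rightSlice hm]
  · let β := Module.finBasis k H
    apply (β.tensorProduct β).ext_elem
    rintro ⟨i, j⟩
    have h1 := hpq (toConv (β.coord i)) (toConv (β.coord j))
    rw [conv_apply _ _ (ℛ k (leftSlice m Λ))] at h1
    conv_lhs => rw [← (ℛ k (leftSlice m Λ)).eq]
    simpa [mul_comm] using h1

include hl

omit hm in
theorem IsIdempotentIntegral.eq_mulLeft_leftSlice :
    m = l ∘ₗ LinearMap.mulLeft k (antipode k (leftSlice m Λ)) :=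
  hΛ.leftSlice_inj (hΛ.leftSlice_mulLeft_antipode hl _).symm

/-- Radford's formula for S⁴ in the unimodular case: m is a translate of l, so its Nakayama relation
can be rewritten through that of l. -/
theorem IsIdempotentIntegral.antipode_pow_four (h : H) :
    antipode k (antipode k (antipode k (antipode k h))) * antipode k (leftSlice m Λ) =
      antipode k (leftSlice m Λ) * h := by
  rw [← sub_eq_zero]
  apply hΛ.nondegenerate hl
  intro x
  have e := LinearMap.congr_fun (hΛ.eq_mulLeft_leftSlice hl (m := m))
  simp only [LinearMap.comp_apply, LinearMap.mulLeft_apply] at e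
  have h1 := hΛ.nakayama_right hm h x
  rw [e, e, ← mul_assoc, ← hΛ.nakayama_left hl, ← mul_assoc, ← mul_assoc] at h1
  rw [sub_mul, map_sub, sub_eq_zero]
  exact h1

-- Group-like elements are linearly independent, so they form a finite group.
omit hl hm in
theorem IsIdempotentIntegral.isOfFinOrder_of_isGroupLikeElem {g : H} (hg : IsGroupLikeElem k g) :
    ∃ N, 0 < N ∧ g ^ N = 1 := by
  have := hΛ.finite
  have : Finite (GroupLike k H) := (linearIndep_groupLikeVal (R := k) (A := H)).finite
  have h := isOfFinOrder_of_finite (⟨g, hg⟩ : GroupLike k H)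
  obtain ⟨N, hN, h⟩ := isOfFinOrder_iff_pow_eq_one.1 h
  exact ⟨N, hN, by simpa using congrArg GroupLike.val h⟩

end

end DualIntegral

/-! ### Integrality of traces of involutions -/

section Trace

theorem exists_nat_trace_of_isIdempotentElem {k V : Type*} [Field k] [AddCommGroup V] [Module k V]
    [Module.Finite k V] {f : Module.End k V} (hf : IsIdempotentElem f) :
    ∃ n : ℕ, LinearMap.trace k V f = n :=
  ⟨_, (LinearMap.isProj_range_iff_isIdempotentElem f |>.2 hf).trace⟩

/-- The trace of an endomorphism whose square is idempotent and which is fixed by this idempotent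
is an integer. -/
theorem exists_int_trace {k V : Type*} [Field k] [CharZero k] [AddCommGroup V] [Module k V]
    [Module.Finite k V] {f q : Module.End k V} (hf : f * f = q) (hq : q * q = q) (hfq : f * q = f) :
    ∃ a b : ℕ, LinearMap.trace k V f = (a : k) - b ∧ LinearMap.trace k V q = (a : k) + b ∧
      (a = 0 → q + f = 0) ∧ (b = 0 → q - f = 0) := by
  have h20 : (2⁻¹ : k) ≠ 0 := by norm_num
  have hqf : q * f = f := by rw [← hf, mul_assoc, hf, hfq]
  -- (q + f)/2 and (q − f)/2 project onto the ±1-eigenspaces of f; a and b are their ranks.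
  have h1 : IsIdempotentElem ((2⁻¹ : k) • (q + f)) := by
    rw [IsIdempotentElem, smul_mul_smul_comm, add_mul, mul_add, mul_add, hq, hqf, hfq, hf,
      add_comm f q, ← two_smul k (q + f), smul_smul]
    norm_num
  have h2 : IsIdempotentElem ((2⁻¹ : k) • (q - f)) := by
    rw [IsIdempotentElem, smul_mul_smul_comm, sub_mul, mul_sub, mul_sub, hq, hqf, hfq, hf,
      ← neg_sub q f, sub_neg_eq_add, ← two_smul k (q - f), smul_smul]
    norm_num
  obtain ⟨a, ha⟩ := exists_nat_trace_of_isIdempotentElem h1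
  obtain ⟨b, hb⟩ := exists_nat_trace_of_isIdempotentElem h2
  refine ⟨a, b, ?_, ?_, fun h0 => ?_, fun h0 => ?_⟩
  · rw [← ha, ← hb]
    simp only [map_smul, map_add, map_sub, smul_eq_mul]
    ring
  · rw [← ha, ← hb]
    simp only [map_smul, map_add, map_sub, smul_eq_mul]
    ring
  · rw [h0, Nat.cast_zero] at ha
    exact (smul_eq_zero.1 (LinearMap.IsIdempotentElem.eq_zero_of_trace_eq_zero h1 ha)).resolve_left
      h20
  · rw [h0, Nat.cast_zero] at hb
    exact (smul_eq_zero.1 (LinearMap.IsIdempotentElem.eq_zero_of_trace_eq_zero h2 hb)).resolve_left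
      h20

end Trace

/-! ### The regular character is idempotent up to a scalar -/

section RegularCharacter

open WithConv

variable (k : Type u) (H : Type v) [Field k] [Ring H] [HopfAlgebra k H]

/-- The character of the left regular representation. -/
def regularCharacter : WithConv (H →ₗ[k] k) :=
  toConv (LinearMap.trace k H ∘ₗ LinearMap.mul k H)

/-- The automorphism `x ⊗ y ↦ ∑ x₁ ⊗ x₂ y`. -/
def fusion : (H ⊗[k] H) →ₗ[k] H ⊗[k] H :=
  TensorProduct.lift ((LinearMap.mul k (H ⊗[k] H)).compl₁₂ comul
    (Algebra.TensorProduct.includeRight : H →ₐ[k] H ⊗[k] H).toLinearMap)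

variable {k H}

theorem fusion_tmul (x y : H) :
    fusion k H (x ⊗ₜ y) = comul (R := k) x * (1 ⊗ₜ[k] y) := rfl

theorem fusion_mul (z : H ⊗[k] H) (y : H) :
    fusion k H (z * (1 ⊗ₜ y)) = fusion k H z * (1 ⊗ₜ[k] y) := by
  induction z with
  | zero => simp
  | add a b ha hb => rw [add_mul, map_add, ha, hb, map_add, add_mul]
  | tmul a b => simp [fusion_tmul, mul_assoc]

theorem fusion_surjective : Function.Surjective (fusion k H) := by
  rw [← LinearMap.range_eq_top, eq_top_iff, ← TensorProduct.span_tmul_eq_top, Submodule.span_le]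
  rintro _ ⟨x, y, rfl⟩
  have h1 : fusion k H (∑ i ∈ (ℛ k x).index, (ℛ k x).left i ⊗ₜ antipode k ((ℛ k x).right i)) =
      x ⊗ₜ[k] 1 := by
    have h : toConv (comul : H →ₗ[k] H ⊗[k] H) *
        toConv ((Algebra.TensorProduct.includeRight : H →ₐ[k] H ⊗[k] H).toLinearMap ∘ₗ antipode k) =
      toConv (Algebra.TensorProduct.includeLeft : H →ₐ[k] H ⊗[k] H).toLinearMap := by
      rw [← includeLeft_conv_includeRight, mul_assoc, algHom_conv_antipode, mul_one]
    have h2 := congrArg (fun f => f.ofConv x) h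
    simp only [conv_apply _ _ (ℛ k x)] at h2
    simpa [map_sum, fusion_tmul] using h2
  refine ⟨(∑ i ∈ (ℛ k x).index, (ℛ k x).left i ⊗ₜ antipode k ((ℛ k x).right i)) * (1 ⊗ₜ y), ?_⟩
  rw [fusion_mul, h1]
  simp

variable [Module.Finite k H]

/-- `fusion` as a linear equivalence. -/
def fusionEquiv : (H ⊗[k] H) ≃ₗ[k] H ⊗[k] H :=
  LinearEquiv.ofBijective (fusion k H)
    ⟨LinearMap.injective_iff_surjective.2 fusion_surjective, fusion_surjective⟩

/-- The fusion map carries the action of h on the first factor alone to the diagonal action, so H ⊗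
H is a sum of dim H copies of H. -/
theorem regularCharacter_mul_self :
    regularCharacter k H * regularCharacter k H = (finrank k H : k) • regularCharacter k H := by
  apply WithConv.ext
  ext h
  let L : H →ₗ[k] Module.End k H := LinearMap.mul k H
  have h1 : LinearMap.trace k (H ⊗[k] H) (LinearMap.mulLeft k (comul (R := k) h)) =
      (regularCharacter k H * regularCharacter k H).ofConv h := by
    rw [conv_apply _ _ (ℛ k h), ← (ℛ k h).eq]
    have h2 : LinearMap.mulLeft k (∑ i ∈ (ℛ k h).index, (ℛ k h).left i ⊗ₜ[k] (ℛ k h).right i) =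
        ∑ i ∈ (ℛ k h).index, TensorProduct.map (L ((ℛ k h).left i)) (L ((ℛ k h).right i)) := by
      apply TensorProduct.ext'
      intro x y
      simp [L, Finset.sum_mul, LinearMap.sum_apply]
    rw [h2, map_sum]
    simp only [LinearMap.trace_tensorProduct']
    rfl
  have h3 : (fusionEquiv (k := k) (H := H)).conj (TensorProduct.map (L h) LinearMap.id) =
      LinearMap.mulLeft k (comul (R := k) h) := by
    apply LinearMap.ext
    intro z
    obtain ⟨z, rfl⟩ := (fusionEquiv (k := k) (H := H)).surjective z
    rw [LinearEquiv.conj_apply_apply, LinearEquiv.symm_apply_apply]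
    change fusion k H _ = comul (R := k) h * fusion k H z
    induction z with
    | zero => simp
    | add a b ha hb => rw [map_add, map_add, map_add, ha, hb, mul_add]
    | tmul a b => simp [fusion_tmul, L, mul_assoc]
  rw [← h1, ← h3, LinearMap.trace_conj', LinearMap.trace_tensorProduct', LinearMap.trace_id]
  exact mul_comm _ _

end RegularCharacter

/-! ### S² = id, provided tr(S²) ≠ 0 -/

section Involution

open WithConv

variable {k : Type u} {H : Type v} [Field k] [Ring H] [HopfAlgebra k H]
  {Λ : H} (hΛ : IsIdempotentIntegral k H Λ)
  {l : H →ₗ[k] k} (hl : leftSlice l Λ = 1)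

include hΛ

theorem IsIdempotentIntegral.regularCharacter_apply [Module.Finite k H] :
    (regularCharacter k H).ofConv Λ = 1 := by
  have h : LinearMap.mul k H Λ = (counit (R := k) (A := H)).smulRight Λ := by
    ext x
    simp [hΛ.mul_right]
  change LinearMap.trace k H (LinearMap.mul k H Λ) = 1
  rw [h, LinearMap.trace_smulRight, hΛ.counit_eq_one]

include hl

/-- The trace of the composition of the antipode with an endomorphism. -/
theorem IsIdempotentIntegral.trace_antipode_comp (g : H →ₗ[k] H) :
    LinearMap.trace k H (antipode k ∘ₗ g) = l ((toConv LinearMap.id * toConv g).ofConv Λ) := by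
  have := hΛ.finite
  have h : (antipode k ∘ₗ g : H →ₗ[k] H) = ∑ i ∈ (ℛ k Λ).index,
      (l ∘ₗ LinearMap.mulLeft k ((ℛ k Λ).left i) ∘ₗ g).smulRight ((ℛ k Λ).right i) := by
    ext h
    have h1 := hΛ.leftSlice_comp_mulRight hl (g h)
    rw [leftSlice_apply _ (ℛ k Λ)] at h1
    simpa [LinearMap.sum_apply] using h1.symm
  rw [h, map_sum, conv_apply _ _ (ℛ k Λ), map_sum]
  simp only [LinearMap.trace_smulRight]
  rfl

theorem IsIdempotentIntegral.trace_antipode_sq :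
    LinearMap.trace k H (antipode k ∘ₗ antipode k) = l 1 := by
  rw [hΛ.trace_antipode_comp hl, LinearMap.id_mul_antipode]
  change l (algebraMap k H (counit (R := k) Λ)) = _
  rw [hΛ.counit_eq_one, map_one]

/-- The product lm equals both l(1)m and m(1)l. Both forms take the value 1 at Λ, so l = m, and the
left and right Nakayama relations combine to S⁴ = id. -/
theorem IsIdempotentIntegral.antipode_pow_four_eq (h1 : l 1 ≠ 0) (h : H) :
    antipode k (antipode k (antipode k (antipode k h))) = h := by
  obtain ⟨m, hm⟩ := hΛ.exists_rightSlice_eq_one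
  have e1 := hΛ.right_integral hl (toConv m)
  rw [hΛ.left_integral hm] at e1
  have e2 : l 1 = m 1 := by
    have := congrArg (fun f => f.ofConv Λ) e1
    simpa [apply_eq_one_of_leftSlice hl, apply_eq_one_of_rightSlice hm] using this
  have e3 : m = l := by
    have h3 : l 1 • toConv m = l 1 • toConv l := by
      rw [e2]
      rw [← e2]
      exact e1.trans (by simp [e2])
    exact congrArg WithConv.ofConv (smul_right_injective _ h1 h3)
  subst e3
  rw [← sub_eq_zero]
  apply hΛ.nondegenerate hl
  intro x
  rw [sub_mul, map_sub, sub_eq_zero, hΛ.nakayama_left hl, hΛ.nakayama_right hm]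

/-- If the trace of the square of the antipode is nonzero, then the antipode is an involution. -/
theorem IsIdempotentIntegral.antipode_antipode_of_ne_zero [CharZero k] (h1 : l 1 ≠ 0) (h : H) :
    antipode k (antipode k h) = h := by
  have := hΛ.finite
  have hnt : Nontrivial H := by
    refine ⟨⟨Λ, 0, fun h0 => ?_⟩⟩
    have := hΛ.counit_eq_one
    rw [h0, map_zero] at this
    exact zero_ne_one this
  have hd : 0 < finrank k H := Module.finrank_pos
  have hdk : (finrank k H : k) ≠ 0 := by exact_mod_cast hd.ne'
  let σ : Module.End k H := antipode k ∘ₗ antipode k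
  have hσσ : σ * σ = 1 := LinearMap.ext fun x => hΛ.antipode_pow_four_eq hl h1 x
  let e : WithConv (H →ₗ[k] k) := (finrank k H : k)⁻¹ • regularCharacter k H
  have he : e * e = e := by
    simp only [e]
    rw [smul_mul_smul_comm, regularCharacter_mul_self, smul_smul]
    congr 1
    field_simp
  have heσ : ∀ x, e.ofConv (σ x) = e.ofConv x := by
    intro x
    let τ : H ≃ₗ[k] H := LinearEquiv.ofLinearMap σ σ hσσ hσσ
    have h2 : LinearMap.mul k H (σ x) = τ.conj (LinearMap.mul k H x) := by
      ext y
      have h3 : σ (σ y) = y := LinearMap.congr_fun hσσ y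
      rw [LinearEquiv.conj_apply_apply]
      change σ x * y = σ (x * σ y)
      conv_lhs => rw [← h3]
      simp [σ, antipode_mul_antidistrib]
    change _ * LinearMap.trace k H (LinearMap.mul k H (σ x)) =
      _ * LinearMap.trace k H (LinearMap.mul k H x)
    rw [h2, LinearMap.trace_conj']
  -- Q is the projection given by the idempotent e of H*. It commutes with σ = S², so σQ squares to
  -- Q and has integral trace.
  let Q : Module.End k H := rightSlice e.ofConv
  have hQQ : Q * Q = Q := by
    change rightSlice e.ofConv ∘ₗ rightSlice e.ofConv = rightSlice e.ofConv
    rw [← rightSlice_mul, he]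
  have hσQ : σ * Q = Q * σ := by
    ext x
    change σ (rightSlice e.ofConv x) = rightSlice e.ofConv (σ x)
    have hr : comul (R := k) (σ x) = ∑ i ∈ (ℛ k x).index,
        σ ((ℛ k x).left i) ⊗ₜ[k] σ ((ℛ k x).right i) := by
      let r : Coalgebra.Repr k (antipode k x) (H × H) := ⟨(ℛ k x).index,
        fun i => antipode k ((ℛ k x).right i), fun i => antipode k ((ℛ k x).left i),
        (comul_antipode (ℛ k x)).symm⟩
      exact comul_antipode r
    let r : Coalgebra.Repr k (σ x) (H × H) := ⟨(ℛ k x).index,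
        fun i => σ ((ℛ k x).left i), fun i => σ ((ℛ k x).right i), hr.symm⟩
    rw [rightSlice_apply _ (ℛ k x), rightSlice_apply _ r]
    simp [r, heσ]
  have htr : LinearMap.trace k H (σ * Q) = (finrank k H : k)⁻¹ * l 1 := by
    have h2 := hΛ.trace_antipode_comp hl (toConv (antipode k (A := H)) * scalarConv H e.ofConv).ofConv
    have h3 : antipode k ∘ₗ (toConv (antipode k (A := H)) * scalarConv H e.ofConv).ofConv =
        σ * Q := by
      rw [toConv_mul_scalarConv]
      rfl
    rw [h3, toConv_ofConv, ← mul_assoc, LinearMap.id_mul_antipode, one_mul, scalarConv_apply] at h2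
    rw [h2, Algebra.algebraMap_eq_smul_one, map_smul, smul_eq_mul]
    congr 1
    change _ * (regularCharacter k H).ofConv Λ = _
    rw [hΛ.regularCharacter_apply, mul_one]
  have hσ1 : LinearMap.trace k H σ = l 1 := hΛ.trace_antipode_sq hl
  obtain ⟨a, b, hab, -⟩ := exists_int_trace (f := σ * Q) (q := Q)
    (by rw [hσQ, mul_assoc, ← mul_assoc σ Q, hσQ, mul_assoc Q σ, hσσ, mul_one, hQQ])
    hQQ (by rw [mul_assoc, hQQ])
  obtain ⟨c, d, hcd, hcd', hc, hd'⟩ := exists_int_trace (f := σ) (q := 1) hσσ (mul_one 1) (mul_one σ)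
  rw [LinearMap.trace_one] at hcd'
  -- Here tr(σ) = l(1) = c − d and tr(σQ) = l(1)/dim H = a − b.
  have hint : ((c : ℤ) - d) = (finrank k H : ℤ) * (a - b) := by
    have : (c : k) - d = (finrank k H : k) * (a - b) := by
      rw [← hab, htr, ← hcd, hσ1]
      field_simp
    exact_mod_cast this
  have hsum : finrank k H = c + d := by exact_mod_cast hcd'
  have hne : (c : ℤ) - d ≠ 0 := by
    intro h0
    apply h1
    rw [← hσ1, hcd]
    exact_mod_cast h0
  -- c − d is a nonzero multiple of dim H = c + d, so one of the two multiplicities vanishes.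
  have hcases : c = 0 ∨ d = 0 := by
    have hx : ((a : ℤ) - b) ≠ 0 := by
      intro h0
      rw [h0, mul_zero] at hint
      exact hne hint
    rw [hsum] at hint
    push_cast at hint
    by_contra! hcon
    have hc0 : 0 < (c : ℤ) := by omega
    have hd0 : 0 < (d : ℤ) := by omega
    rcases lt_or_gt_of_ne hx with hx | hx
    · nlinarith
    · nlinarith
  rcases hcases with h0 | h0
  -- c = 0 would mean S² = −id, contradicting S²(1) = 1.
  · exfalso
    have h3 := LinearMap.congr_fun (hc h0) 1
    have h4 : σ 1 = 1 := by simp [σ]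
    have h5 : (1 : H) + 1 = 0 := by
      rw [LinearMap.add_apply, h4] at h3
      exact h3
    have h6 : (2 : k) • (1 : H) = 0 := by rw [two_smul, h5]
    exact (smul_ne_zero two_ne_zero one_ne_zero) h6
  · exact (sub_eq_zero.1 (LinearMap.congr_fun (hd' h0) h)).symm

end Involution

/-! ### Traces of endomorphisms of finite projective order -/

section LinearAlgebra

variable {k : Type*} [Field k]

theorem trace_eq_mul_trace {V W : Type*} [AddCommGroup V] [Module k V] [Module.Finite k V]
    [AddCommGroup W] [Module k W] [Module.Finite k W] {F : Module.End k (V →ₗ[k] W)}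
    {A : Module.End k W} {B : Module.End k V} (hF : ∀ f, F f = A ∘ₗ f ∘ₗ B) :
    LinearMap.trace k (V →ₗ[k] W) F = LinearMap.trace k W A * LinearMap.trace k V B := by
  classical
  let b := Module.finBasis k V
  let c := Module.finBasis k W
  rw [LinearMap.trace_eq_matrix_trace k (b.linearMap c), LinearMap.trace_eq_matrix_trace k b,
    LinearMap.trace_eq_matrix_trace k c, Matrix.trace, Matrix.trace, Matrix.trace,
    Finset.sum_mul_sum, ← Finset.univ_product_univ, Finset.sum_product]
  refine Finset.sum_congr rfl fun i _ => Finset.sum_congr rfl fun j _ => ?_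
  have h1 : (b.linearMap c).repr (A ∘ₗ b.linearMap c (i, j) ∘ₗ B) (i, j) =
      LinearMap.toMatrix b c (A ∘ₗ b.linearMap c (i, j) ∘ₗ B) i j := by
    rfl
  rw [Matrix.diag_apply, LinearMap.toMatrix_apply, hF, h1, LinearMap.toMatrix_comp b c c,
    LinearMap.toMatrix_comp b b c, Basis.linearMap_apply, LinearMap.toMatrix_toLin,
    Matrix.stdBasis_eq_single]
  simp [Matrix.mul_apply, Matrix.single_apply, ite_and]

theorem exists_eigenbasis_of_pow_eq_one [IsAlgClosed k] [CharZero k] {V : Type*} [AddCommGroup V]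
    [Module k V] [Module.Finite k V] {u : Module.End k V} {M : ℕ} (hM : 0 < M) (hu : u ^ M = 1) :
    ∃ (b : Basis (Fin (finrank k V)) k V) (z : Fin (finrank k V) → k),
      ∀ j, u (b j) = z j • b j := by
  classical
  have hss : u.IsSemisimple := by
    apply Module.End.isSemisimple_of_squarefree_aeval_eq_zero (p := Polynomial.X ^ M - 1)
    · exact (Polynomial.X_pow_sub_one_separable_iff.2 (by exact_mod_cast hM.ne')).squarefree
    · simp [hu]
  have hI := DirectSum.isInternal_submodule_of_iSupIndep_of_iSup_eq_top
    u.eigenspaces_iSupIndep hss.iSup_eigenspace_eq_top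
  let b := hI.collectedBasis fun μ => Module.finBasis k (Module.End.eigenspace u μ)
  have := FiniteDimensional.fintypeBasisIndex b
  let e := Fintype.equivFinOfCardEq (Module.finrank_eq_card_basis b).symm
  refine ⟨b.reindex e, fun j => (e.symm j).1, fun j => ?_⟩
  rw [Basis.reindex_apply]
  exact Module.End.mem_eigenspace_iff.1 (hI.collectedBasis_mem _ (e.symm j))

theorem trace_eq_sum_of_eigenbasis {V : Type*} [AddCommGroup V] [Module k V] {ι : Type*} [Fintype ι]
    (b : Basis ι k V) {u : Module.End k V} {z : ι → k} (h : ∀ j, u (b j) = z j • b j) :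
    LinearMap.trace k V u = ∑ j, z j := by
  classical
  rw [LinearMap.trace_eq_matrix_trace k b, Matrix.trace]
  refine Finset.sum_congr rfl fun j _ => ?_
  simp [LinearMap.toMatrix_apply, h]

/-- Dividing w by an M-th root of c makes its eigenvalues roots of unity and does not change the
product of traces. Inverses become complex conjugates under σ, so the product becomes a squared
absolute value. -/
theorem exists_trace_mul_trace_nonneg [IsAlgClosed k] [CharZero k]
    (σ : algebraicClosure ℚ k →ₐ[ℚ] ℂ) {V : Type*} [AddCommGroup V]
    [Module k V] [Module.Finite k V] {w w' : Module.End k V} (hw : w * w' = 1) {M : ℕ} (hM : 0 < M)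
    {c : k} (hc : w ^ M = c • 1) :
    ∃ (a : algebraicClosure ℚ k) (r : ℝ), 0 ≤ r ∧ σ a = r ∧
      (a : k) = LinearMap.trace k V w * LinearMap.trace k V w' := by
  by_cases hc0 : c = 0
  -- An invertible w with w ^ M = 0 lives on the zero space.
  · have hww' : w' * w = 1 := mul_eq_one_comm.1 hw
    have h1 : w ^ M * w' ^ M = 1 := by
      rw [← (show Commute w w' from hw.trans hww'.symm).mul_pow, hw, one_pow]
    rw [hc, hc0, zero_smul, zero_mul] at h1
    refine ⟨0, 0, le_rfl, by simp, ?_⟩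
    have h2 : w = 0 := by rw [← mul_one w, ← h1, mul_zero]
    simp [h2]
  · obtain ⟨d, hd⟩ := IsAlgClosed.exists_pow_nat_eq c hM
    have hd0 : d ≠ 0 := by
      rintro rfl
      rw [zero_pow hM.ne'] at hd
      exact hc0 hd.symm
    have hu : (d⁻¹ • w) ^ M = 1 := by
      rw [smul_pow, hc, smul_smul, inv_pow, hd, inv_mul_cancel₀ hc0, one_smul]
    obtain ⟨b, z, hz⟩ := exists_eigenbasis_of_pow_eq_one hM hu
    have hzM : ∀ j, z j ^ M = 1 := by
      intro j
      have h1 : ∀ n : ℕ, ((d⁻¹ • w) ^ n) (b j) = z j ^ n • b j := by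
        intro n
        induction n with
        | zero => simp
        | succ n ih => rw [pow_succ, Module.End.mul_apply, hz, map_smul, ih, smul_smul, pow_succ']
      have h2 := h1 M
      rw [hu, Module.End.one_apply] at h2
      have h3 : (1 - z j ^ M) • b j = 0 := by rw [sub_smul, one_smul, ← h2, sub_self]
      exact (sub_eq_zero.1 ((smul_eq_zero.1 h3).resolve_right (b.ne_zero j))).symm
    have hz0 : ∀ j, z j ≠ 0 := by
      intro j h0
      have := hzM j
      rw [h0, zero_pow hM.ne'] at this
      exact zero_ne_one this
    have hz' : ∀ j, (d • w') (b j) = (z j)⁻¹ • b j := by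
      intro j
      have h1 : (d • w') ((d⁻¹ • w) (b j)) = b j := by
        rw [LinearMap.smul_apply, LinearMap.smul_apply, map_smul, smul_smul, mul_inv_cancel₀ hd0,
          one_smul]
        exact LinearMap.congr_fun (mul_eq_one_comm.1 hw) (b j)
      rw [hz, map_smul] at h1
      rw [← inv_smul_smul₀ (hz0 j) ((d • w') (b j)), h1]
    have halg : ∀ j, z j ∈ algebraicClosure ℚ k := by
      intro j
      rw [mem_algebraicClosure_iff]
      exact (IsIntegral.of_pow hM (by rw [hzM j]; exact isIntegral_one)).isAlgebraic
    let ζ : Fin (finrank k V) → algebraicClosure ℚ k := fun j => ⟨z j, halg j⟩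
    refine ⟨(∑ j, ζ j) * ∑ j, (ζ j)⁻¹, Complex.normSq (∑ j, σ (ζ j)), Complex.normSq_nonneg _, ?_, ?_⟩
    · rw [map_mul, map_sum, map_sum, Complex.normSq_eq_conj_mul_self, map_sum, mul_comm]
      congr 1
      refine Finset.sum_congr rfl fun j _ => ?_
      have h1 : σ (ζ j) ^ M = 1 := by
        rw [← map_pow, ← map_one σ]
        congr 1
        exact Subtype.ext (hzM j)
      rw [map_inv₀, Complex.inv_eq_conj (Complex.norm_eq_one_of_pow_eq_one h1 hM.ne')]
    · have h1 := trace_eq_sum_of_eigenbasis b hz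
      have h2 := trace_eq_sum_of_eigenbasis b hz'
      rw [map_smul, smul_eq_mul] at h1 h2
      have h3 : LinearMap.trace k V w * LinearMap.trace k V w' = (∑ j, z j) * ∑ j, (z j)⁻¹ := by
        rw [← h1, ← h2]
        field_simp
      rw [h3]
      push_cast
      simp [ζ]

theorem sum_trace_mul_trace_ne_zero [IsAlgClosed k] [CharZero k] {ι : Type*} [Fintype ι]
    {V : ι → Type*} [∀ i, AddCommGroup (V i)] [∀ i, Module k (V i)] [∀ i, Module.Finite k (V i)]
    (w w' : ∀ i, Module.End k (V i)) (hw : ∀ i, w i * w' i = 1) {M : ℕ} (hM : 0 < M)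
    (hc : ∀ i, ∃ c : k, w i ^ M = c • 1) (i₀ : ι)
    (h₀ : LinearMap.trace k (V i₀) (w i₀) * LinearMap.trace k (V i₀) (w' i₀) = 1) :
    ∑ i, LinearMap.trace k (V i) (w i) * LinearMap.trace k (V i) (w' i) ≠ 0 := by
  have : Algebra.IsAlgebraic ℚ (algebraicClosure ℚ k) := by
    convert algebraicClosure.isAlgebraic ℚ k
    · rfl
    · exact Subsingleton.elim _ _
  let σ : algebraicClosure ℚ k →ₐ[ℚ] ℂ := IsAlgClosed.lift
  choose c hc using hc
  choose a r hr hσ ha using fun i => exists_trace_mul_trace_nonneg σ (hw i) hM (hc i)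
  intro hsum
  have h1 : ∑ i, a i = 0 := by
    apply Subtype.ext
    push_cast
    rw [← hsum]
    exact Finset.sum_congr rfl fun i _ => ha i
  have h2 : ∑ i, r i = 0 := by
    have := congrArg σ h1
    rw [map_sum, map_zero, Finset.sum_congr rfl fun i _ => hσ i] at this
    exact_mod_cast this
  have h3 := (Finset.sum_eq_zero_iff_of_nonneg fun i _ => hr i).1 h2 i₀ (Finset.mem_univ _)
  have h4 : a i₀ = 1 := Subtype.ext ((ha i₀).trans h₀)
  have h5 := hσ i₀
  rw [h4, h3, map_one] at h5
  norm_num at h5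

end LinearAlgebra

/-! ### Faithfulness and density for the family of simple modules -/

section Wedderburn

variable {k : Type u} {R : Type v} [Field k] [IsAlgClosed k] [Ring R] [Algebra k R]
  [IsSemisimpleRing R]
  {ι : Type*} {V : ι → Type w} [∀ i, AddCommGroup (V i)]
  [∀ i, Module k (V i)] [∀ i, Module R (V i)] [∀ i, IsScalarTower k R (V i)]
  [∀ i, IsSimpleModule R (V i)]

theorem finite_of_isSimpleModule (k : Type u) {R : Type v} [Field k] [Ring R] [Algebra k R]
    [Module.Finite k R] (M : Type w) [AddCommGroup M] [Module k M] [Module R M] [IsScalarTower k R M]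
    [IsSimpleModule R M] : Module.Finite k M :=
  Module.Finite.trans R M

theorem IsCompleteSetOfIrreducibles.eq_zero (hV : IsCompleteSetOfIrreducibles R V) {h : R}
    (h0 : ∀ i (x : V i), h • x = 0) : h = 0 := by
  have h1 : ∀ x : R, x ∈ (⊤ : Submodule R R) → h * x = 0 := by
    rw [← IsSemisimpleModule.sSup_simples_eq_top R R, sSup_eq_iSup]
    intro x hx
    induction hx using Submodule.iSup_induction' with
    | mem N x hx =>
      induction hx using Submodule.iSup_induction' with
      | mem hN x hx =>
        have : IsSimpleModule R N := hN
        obtain ⟨i, ⟨e⟩⟩ := hV.complete N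
        have h2 : h • (⟨x, hx⟩ : N) = 0 := by
          apply e.injective
          rw [map_smul, h0, map_zero]
        exact congrArg Subtype.val h2
      | zero => exact mul_zero h
      | add x y _ _ hx hy => rw [mul_add, hx, hy, add_zero]
    | zero => exact mul_zero h
    | add x y _ _ hx hy => rw [mul_add, hx, hy, add_zero]
  simpa using h1 1 trivial

/-- By Schur, R-endomorphisms of the product of the V_i are diagonal with scalar entries, so they
commute with any family f. Jacobson density on a k-basis then realizes f by a ring element. -/
theorem IsCompleteSetOfIrreducibles.exists_smul_eq [Fintype ι] [DecidableEq ι]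
    [∀ i, Module.Finite k (V i)]
    (hV : IsCompleteSetOfIrreducibles R V) (f : ∀ i, Module.End k (V i)) :
    ∃ h : R, ∀ i (x : V i), h • x = f i x := by
  classical
  let F : (∀ i, V i) →ₗ[k] ∀ i, V i := LinearMap.pi fun i => f i ∘ₗ LinearMap.proj i
  have hF : ∀ (φ : Module.End R (∀ i, V i)) x, F (φ x) = φ (F x) := by
    intro φ x
    have hφ : ∀ i j, ∃ c : k, ∀ y : V j, φ (Pi.single j y) i = if h : j = i then c • (h ▸ y) else 0 := by
      intro i j
      let ψ : V j →ₗ[R] V i := LinearMap.proj i ∘ₗ φ ∘ₗ LinearMap.single R V j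
      by_cases hij : j = i
      · subst hij
        obtain ⟨c, hc⟩ := (IsSimpleModule.algebraMap_end_bijective_of_isAlgClosed k
          (A := R) (V := V j)).2 ψ
        refine ⟨c, fun y => ?_⟩
        have := LinearMap.congr_fun hc y
        simpa [ψ] using this.symm
      · refine ⟨0, fun y => ?_⟩
        have h0 : ψ = 0 := by
          refine ψ.bijective_or_eq_zero.resolve_left fun hb => hij ?_
          exact hV.pairwise_not_iso _ _ ⟨LinearEquiv.ofBijective ψ hb⟩
        have := LinearMap.congr_fun h0 y
        simpa [hij, ψ] using this
    choose c hc using hφ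
    have hφ : ∀ y i, φ y i = c i i • y i := by
      intro y i
      have h1 : y = ∑ j, Pi.single j (y j) := (Finset.univ_sum_single y).symm
      conv_lhs => rw [h1]
      rw [map_sum, Finset.sum_apply, Finset.sum_eq_single i]
      · rw [hc]; simp
      · intro j _ hj
        rw [hc, dif_neg hj]
      · simp
    ext i
    simp [F, hφ]
  let F' : Module.End (Module.End R (∀ i, V i)) (∀ i, V i) :=
    { toFun := F
      map_add' := map_add F
      map_smul' := hF }
  let b := Module.finBasis k (∀ i, V i)
  obtain ⟨h, hh⟩ := jacobson_density F' (Finset.univ.image b)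
  have h1 : F = Algebra.lsmul k k (∀ i, V i) h := by
    apply b.ext
    intro j
    exact hh (b j) (Finset.mem_image_of_mem _ (Finset.mem_univ _))
  refine ⟨h, fun i x => ?_⟩
  have h2 := congrFun (LinearMap.congr_fun h1 (Pi.single i x)) i
  simpa [F] using h2.symm

end Wedderburn

section Characters

open WithConv

variable {k : Type u} {H : Type v} [Field k] [Ring H] [Algebra k H]
  {V : Type w} [AddCommGroup V] [Module k V] [Module H V] [IsScalarTower k H V]

/-- The representation afforded by the module `V`. -/
abbrev rep (k : Type u) (H : Type v) [Field k] [Ring H] [Algebra k H]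
    (V : Type w) [AddCommGroup V] [Module k V] [Module H V] [IsScalarTower k H V] :
    H →ₐ[k] Module.End k V :=
  Algebra.lsmul k k V

theorem exists_smul_of_mem_center [IsAlgClosed k] [Module.Finite k V] [IsSimpleModule H V] {z : H}
    (hz : ∀ h, h * z = z * h) : ∃ c : k, rep k H V z = c • 1 := by
  let φ : Module.End H V :=
    { toFun := fun x => z • x
      map_add' := smul_add z
      map_smul' := fun h x => by
        simp only [RingHom.id_apply]
        rw [← mul_smul, ← mul_smul, hz] }
  obtain ⟨c, hc⟩ := (IsSimpleModule.algebraMap_end_bijective_of_isAlgClosed k (A := H) (V := V)).2 φ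
  refine ⟨c, LinearMap.ext fun x => ?_⟩
  exact (LinearMap.congr_fun hc x).symm

end Characters

/-! ### Nonvanishing of tr(S²) -/

section Involution

open WithConv

variable {k : Type u} {H : Type v} [Field k] [Ring H] [HopfAlgebra k H]

theorem finrank_eq_one_of_trivial {V : Type w} [AddCommGroup V] [Module k V] [Module H V]
    [IsScalarTower k H V] [IsSimpleModule H V]
    (hV : ∀ (h : H) (x : V), h • x = (counit (R := k) h) • x) : finrank k V = 1 := by
  have := IsSimpleModule.nontrivial H V
  obtain ⟨v, hv⟩ := exists_ne (0 : V)
  rw [finrank_eq_one_iff_of_nonzero' v hv]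
  intro x
  obtain ⟨h, hh⟩ := IsSimpleModule.toSpanSingleton_surjective H hv x
  exact ⟨counit (R := k) h, by rw [← hV]; exact hh⟩

variable [IsAlgClosed k] [IsSemisimpleRing H]
  {ι : Type*} [Fintype ι] {V : ι → Type w} [∀ i, AddCommGroup (V i)]
  [∀ i, Module k (V i)] [∀ i, Module H (V i)] [∀ i, IsScalarTower k H (V i)]
  [∀ i, IsSimpleModule H (V i)]

/-- The sum of the characters of the modules `V i`. -/
def characterSum (k : Type u) (H : Type v) [Field k] [Ring H] [HopfAlgebra k H]
    {ι : Type*} [Fintype ι] (V : ι → Type w) [∀ i, AddCommGroup (V i)]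
    [∀ i, Module k (V i)] [∀ i, Module H (V i)] [∀ i, IsScalarTower k H (V i)] : H →ₗ[k] k :=
  ∑ i, LinearMap.trace k (V i) ∘ₗ (rep k H (V i)).toLinearMap

omit [IsAlgClosed k] [IsSemisimpleRing H] [∀ i, IsSimpleModule H (V i)] in
theorem characterSum_apply (h : H) :
    characterSum k H V h = ∑ i, LinearMap.trace k (V i) (rep k H (V i) h) := by
  simp [characterSum, LinearMap.sum_apply]

omit [IsAlgClosed k] [IsSemisimpleRing H] [∀ i, IsSimpleModule H (V i)] in
theorem characterSum_mul_comm (x y : H) :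
    characterSum k H V (x * y) = characterSum k H V (y * x) := by
  simp only [characterSum_apply, map_mul]
  exact Finset.sum_congr rfl fun i _ => LinearMap.trace_mul_comm k _ _

omit [IsAlgClosed k] [IsSemisimpleRing H] [∀ i, IsSimpleModule H (V i)] in
theorem characterSum_mul_eq {i : ι} {f : Module.End k (V i)} {h : H}
    (hf : rep k H (V i) h = f) (h0 : ∀ j, j ≠ i → rep k H (V j) h = 0) (x : H) :
    characterSum k H V (x * h) = LinearMap.trace k (V i) (rep k H (V i) x * f) := by
  rw [characterSum_apply, Finset.sum_eq_single i]
  · rw [map_mul, hf]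
  · intro j _ hj
    rw [map_mul, h0 j hj, mul_zero, map_zero]
  · simp

variable [∀ i, Module.Finite k (V i)] (hV : IsCompleteSetOfIrreducibles H V)
include hV

theorem IsCompleteSetOfIrreducibles.exists_rep_eq (i : ι) (f : Module.End k (V i)) :
    ∃ h : H, rep k H (V i) h = f ∧ ∀ j, j ≠ i → rep k H (V j) h = 0 := by
  classical
  obtain ⟨h, hh⟩ := hV.exists_smul_eq (k := k) (Pi.single i f)
  refine ⟨h, ?_, fun j hj => ?_⟩
  · ext x
    have := hh i x
    rwa [Pi.single_eq_same] at this
  · ext x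
    have := hh j x
    rwa [Pi.single_eq_of_ne hj] at this

omit [IsAlgClosed k] [Fintype ι] [∀ i, Module.Finite k (V i)] in
theorem IsCompleteSetOfIrreducibles.rep_injective {x : H} (hx : ∀ i, rep k H (V i) x = 0) : x = 0 :=
  hV.eq_zero fun i y => LinearMap.congr_fun (hx i) y

/-- Choosing h to act on one V_i with rank one and as zero on the others reads off every matrix
coefficient of w. -/
theorem IsCompleteSetOfIrreducibles.characterSum_nondegenerate {w : H}
    (hw : ∀ h, characterSum k H V (w * h) = 0) : w = 0 := by
  refine hV.rep_injective (k := k) fun i => ?_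
  ext v
  rw [LinearMap.zero_apply, ← Module.forall_dual_apply_eq_zero_iff k]
  intro φ
  obtain ⟨h, hf, h0⟩ := hV.exists_rep_eq i (φ.smulRight v)
  have h1 := characterSum_mul_eq hf h0 w
  have h2 : rep k H (V i) w * φ.smulRight v = φ.smulRight (rep k H (V i) w v) := by
    ext x
    simp
  rw [hw, h2, LinearMap.trace_smulRight] at h1
  exact h1.symm

theorem IsCompleteSetOfIrreducibles.exists_eq_characterSum [Module.Finite k H] (l : H →ₗ[k] k) :
    ∃ w : H, ∀ h, l h = characterSum k H V (w * h) := by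
  let F : H →ₗ[k] (H →ₗ[k] k) := (LinearMap.mul k H).compr₂ (characterSum k H V)
  have hF : Function.Injective F := by
    rw [injective_iff_map_eq_zero]
    intro w hw
    exact hV.characterSum_nondegenerate fun h => LinearMap.congr_fun hw h
  obtain ⟨w, hw⟩ := (LinearMap.injective_iff_surjective_of_finrank_eq_finrank
    Subspace.dual_finrank_eq.symm).1 hF l
  exact ⟨w, fun h => (LinearMap.congr_fun hw h).symm⟩

section

variable {Λ : H} (hΛ : IsIdempotentIntegral k H Λ) {l : H →ₗ[k] k} (hl : leftSlice l Λ = 1)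
  {w w' : H} (hw : ∀ h, l h = characterSum k H V (w * h)) (hww' : w' * w = 1)
include hΛ hl hw hww'

/-- Since χ is symmetric, the Nakayama relation for l = χ(w·) says w S²(h) = h w. -/
theorem IsCompleteSetOfIrreducibles.antipode_sq_eq (h : H) :
    antipode k (antipode k h) = w' * h * w := by
  have h1 : w * antipode k (antipode k h) - h * w = 0 := by
    apply hV.characterSum_nondegenerate (k := k)
    intro x
    have h2 := hΛ.nakayama_left hl h x
    rw [hw, hw, ← mul_assoc w x h, characterSum_mul_comm (w * x) h, ← mul_assoc, ← mul_assoc] at h2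
    rw [sub_mul, map_sub, h2, sub_self]
  rw [mul_assoc, ← sub_eq_zero.1 h1, ← mul_assoc, hww', one_mul]

/-- From w'h = Σ χ(Λ₁h) S(Λ₂), left multiplication by ρ(w') on End V_i is f ↦ Σ tr(ρ(Λ₁)f) ρ(S Λ₂).
Its trace is d_i·tr ρ(w') on one side and tr ρ(Σ Λ₁S(Λ₂)) = d_i on the other. -/
theorem IsCompleteSetOfIrreducibles.trace_rep_eq_one [CharZero k] (i : ι) :
    LinearMap.trace k (V i) (rep k H (V i) w') = 1 := by
  let r := ℛ k Λ
  have h1 : ∀ h, w' * h = ∑ j ∈ r.index,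
      characterSum k H V (r.left j * h) • antipode k (r.right j) := by
    intro h
    have h2 := hV.antipode_sq_eq hΛ hl hw hww' (h * w')
    rw [mul_assoc, mul_assoc h, hww', mul_one] at h2
    rw [← h2, ← hΛ.leftSlice_comp_mulRight hl (h * w'), leftSlice_apply _ r, map_sum]
    refine Finset.sum_congr rfl fun j _ => ?_
    rw [map_smul, LinearMap.comp_apply, LinearMap.mulRight_apply, hw, characterSum_mul_comm,
      mul_assoc, mul_assoc, hww', mul_one]
  let F : Module.End k (V i →ₗ[k] V i) := ∑ j ∈ r.index,
    (LinearMap.trace k (V i) ∘ₗ LinearMap.mulLeft k (rep k H (V i) (r.left j))).smulRight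
      (rep k H (V i) (antipode k (r.right j)))
  have hF : ∀ f, F f = rep k H (V i) w' ∘ₗ f ∘ₗ LinearMap.id := by
    intro f
    obtain ⟨h, hf, h0⟩ := hV.exists_rep_eq i f
    have h2 := congrArg (rep k H (V i)) (h1 h)
    rw [map_mul, hf, map_sum] at h2
    rw [LinearMap.comp_id, ← Module.End.mul_eq_comp, h2]
    simp only [F, LinearMap.sum_apply]
    refine Finset.sum_congr rfl fun j _ => ?_
    rw [map_smul, characterSum_mul_eq hf h0]
    rfl
  have h3 := trace_eq_mul_trace hF
  have h4 : LinearMap.trace k (V i →ₗ[k] V i) F = (finrank k (V i) : k) := by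
    simp only [F]
    rw [map_sum, ← LinearMap.trace_one, ← map_one (rep k H (V i)), ← hΛ.sum_mul_antipode r, map_sum,
      map_sum]
    refine Finset.sum_congr rfl fun j _ => ?_
    rw [LinearMap.trace_smulRight, map_mul]
    rfl
  rw [h4, LinearMap.trace_id] at h3
  have := IsSimpleModule.nontrivial H (V i)
  have hd : (finrank k (V i) : k) ≠ 0 := by
    exact_mod_cast (Module.finrank_pos (R := k) (M := V i)).ne'
  exact (mul_right_cancel₀ hd ((one_mul _).trans h3)).symm

/-- S⁴ is conjugation both by w² and, by Radford's formula, by a group-like γ. Hence w²γ is central,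
and γ has finite order. -/
theorem IsCompleteSetOfIrreducibles.exists_pow_mem_center (hww : w * w' = 1) :
    ∃ M, 0 < M ∧ ∀ h, h * w ^ M = w ^ M * h := by
  obtain ⟨m, hm⟩ := hΛ.exists_rightSlice_eq_one
  let γ := antipode k (leftSlice m Λ)
  obtain ⟨N, hN, hγ⟩ := hΛ.isOfFinOrder_of_isGroupLikeElem (g := γ)
    (hΛ.isGroupLikeElem_leftSlice hm).antipode
  have hW : w * w * (w' * w') = 1 := by
    rw [mul_assoc, ← mul_assoc w w', hww, one_mul, hww]
  have hW' : w' * w' * (w * w) = 1 := by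
    rw [mul_assoc, ← mul_assoc w' w, hww', one_mul, hww']
  have hz : ∀ h, h * (w * w * γ) = (w * w * γ) * h := by
    intro h
    have h1 : w' * (w' * h * w) * w * γ = γ * h := by
      have := hΛ.antipode_pow_four hl hm h
      rwa [hV.antipode_sq_eq hΛ hl hw hww', hV.antipode_sq_eq hΛ hl hw hww'] at this
    rw [mul_assoc (w * w) γ h, ← h1]
    calc h * (w * w * γ) = (w * w * (w' * w')) * (h * (w * w * γ)) := by rw [hW, one_mul]
      _ = _ := by simp only [mul_assoc]
  -- Centrality of w²γ tested against w² itself, with w² cancelled.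
  have hcomm : Commute (w * w) γ := by
    have h3 : w' * w' * (w * w * (w * w * γ)) = w' * w' * (w * w * (γ * (w * w))) := by
      rw [hz (w * w), mul_assoc (w * w) γ]
    rwa [← mul_assoc (w' * w') (w * w), ← mul_assoc (w' * w') (w * w), hW', one_mul,
      one_mul] at h3
  have hpow : (w * w * γ) ^ N = w ^ (2 * N) := by
    rw [hcomm.mul_pow, hγ, mul_one, pow_mul, sq]
  refine ⟨2 * N, by omega, fun h => ?_⟩
  rw [← hpow]
  exact Commute.pow_right (hz h) N

end

/-- The antipode of a semisimple Hopf algebra in characteristic zero is an involution. -/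
theorem IsCompleteSetOfIrreducibles.antipode_antipode [CharZero k] {Λ : H}
    (hΛ : IsIdempotentIntegral k H Λ) (i₀ : ι)
    (hi₀ : ∀ (h : H) (x : V i₀), h • x = (counit (R := k) h) • x) (h : H) :
    antipode k (antipode k h) = h := by
  have := hΛ.finite
  obtain ⟨l, hl⟩ := hΛ.exists_leftSlice_eq_one
  obtain ⟨w, hw⟩ := hV.exists_eq_characterSum l
  have hinj : Function.Injective (LinearMap.mulLeft k w) := by
    rw [injective_iff_map_eq_zero]
    intro y hy
    apply hΛ.nondegenerate hl
    intro x
    rw [hw, ← mul_assoc]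
    have : w * y = 0 := hy
    rw [this, zero_mul, map_zero]
  obtain ⟨w', hww⟩ := LinearMap.injective_iff_surjective.1 hinj 1
  have hww : w * w' = 1 := hww
  have hww' : w' * w = 1 := by
    apply hinj
    change w * (w' * w) = w * 1
    rw [← mul_assoc, hww, one_mul, mul_one]
  apply hΛ.antipode_antipode_of_ne_zero hl
  obtain ⟨M, hM, hMc⟩ := hV.exists_pow_mem_center hΛ hl hw hww' hww
  -- The traces of w' are all 1, so this sum is χ(w) = l(1); the trivial module contributes
  -- ε(w)ε(w') = 1.
  have h1 := sum_trace_mul_trace_ne_zero (fun i => rep k H (V i) w) (fun i => rep k H (V i) w')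
    (fun i => by rw [← map_mul, hww, map_one]) hM
    (fun i => by
      rw [← map_pow]
      exact exists_smul_of_mem_center hMc) i₀ (by
        have e : ∀ x, rep k H (V i₀) x = (counit (R := k) x) • 1 := fun x =>
          LinearMap.ext fun y => hi₀ x y
        rw [e, e, map_smul, map_smul, LinearMap.trace_one, finrank_eq_one_of_trivial hi₀]
        simp only [Nat.cast_one, smul_eq_mul, mul_one]
        rw [← Bialgebra.counit_mul, hww, Bialgebra.counit_one])
  simp only [hV.trace_rep_eq_one hΛ hl hw hww', mul_one] at h1
  rw [hw, mul_one, characterSum_apply]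
  exact h1

end Involution

/-! ### Powers of a matrix with prescribed first row or column -/

section Matrices

variable {k : Type*} [Field k] {n : ℕ} [NeZero n] {A : Matrix (Fin n) (Fin n) k}

theorem pow_first_row (h0 : ∀ j, A 0 j = if j = 0 then 1 else 0) (m : ℕ) (j : Fin n) :
    (A ^ m) 0 j = if j = 0 then 1 else 0 := by
  induction m generalizing j with
  | zero => simp [Matrix.one_apply, eq_comm]
  | succ m ih =>
    rw [pow_succ, Matrix.mul_apply]
    simp [ih, h0]

theorem pow_first_column (h1 : ∀ i, A i 0 = 1) {m : ℕ} (hm : 0 < m) (i : Fin n) :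
    (A ^ m) i 0 = ∑ j, (A ^ (m - 1)) i j := by
  obtain ⟨m, rfl⟩ := Nat.exists_eq_succ_of_ne_zero hm.ne'
  rw [Nat.succ_sub_one, Nat.succ_eq_add_one, pow_succ, Matrix.mul_apply]
  simp [h1]

/-- In each inductive step the summand j = 0 is already positive, because A i 0 = 1. -/
theorem pow_first_column_pos [CharZero k] (h1 : ∀ i, A i 0 = 1)
    (hA : ∀ i j, ∃ q : ℚ, 0 ≤ q ∧ A i j = (q : k))
    {m : ℕ} (hm : 0 < m) (i : Fin n) : ∃ q : ℚ, 0 < q ∧ (A ^ m) i 0 = (q : k) := by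
  induction m, hm using Nat.le_induction generalizing i with
  | base => exact ⟨1, one_pos, by simp [h1]⟩
  | succ m hm ih =>
    choose q hq hqA using hA
    choose p hp hpA using ih
    refine ⟨∑ j, q i j * p j, ?_, ?_⟩
    · refine Finset.sum_pos' (fun j _ => mul_nonneg (hq i j) (hp j).le) ⟨0, Finset.mem_univ _, ?_⟩
      refine mul_pos (lt_of_le_of_ne (hq i 0) fun h => ?_) (hp 0)
      have := hqA i 0
      rw [h1, ← h, Rat.cast_zero] at this
      exact one_ne_zero this
    · rw [pow_succ', Matrix.mul_apply, Rat.cast_sum]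
      exact Finset.sum_congr rfl fun j _ => by rw [hqA, hpA, Rat.cast_mul]

end Matrices

/-! ### Tensor products, duals, and values of characters at Λ -/

section Multiplicity

open WithConv

variable {k : Type u} {H : Type v} [Field k] [Ring H] [HopfAlgebra k H]

/-- The tensor product of two representations. -/
def tensorRep {V W : Type*} [AddCommGroup V] [Module k V] [AddCommGroup W] [Module k W]
    (ρ : H →ₐ[k] Module.End k V) (σ : H →ₐ[k] Module.End k W) :
    H →ₐ[k] Module.End k (V ⊗[k] W) :=
  (Module.endTensorEndAlgHom (R := k) (S := k) (A := k)).comp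
    ((Algebra.TensorProduct.map ρ σ).comp (Bialgebra.comulAlgHom k H))

/-- The dual of a representation. -/
def dualRep {V : Type*} [AddCommGroup V] [Module k V] (ρ : H →ₐ[k] Module.End k V) :
    H →ₐ[k] Module.End k (Dual k V) :=
  AlgHom.ofLinearMap (Module.Dual.transpose ∘ₗ ρ.toLinearMap ∘ₗ antipode k)
    (by ext; simp [Module.Dual.transpose_apply])
    (fun x y => by
      ext
      simp [antipode_mul_antidistrib, Module.Dual.transpose_apply])

theorem trace_tensorRep {V W : Type*} [AddCommGroup V] [Module k V] [Module.Finite k V]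
    [AddCommGroup W] [Module k W] [Module.Finite k W]
    (ρ : H →ₐ[k] Module.End k V) (σ : H →ₐ[k] Module.End k W) :
    toConv (LinearMap.trace k (V ⊗[k] W) ∘ₗ (tensorRep ρ σ).toLinearMap) =
      toConv (LinearMap.trace k V ∘ₗ ρ.toLinearMap) *
        toConv (LinearMap.trace k W ∘ₗ σ.toLinearMap) := by
  apply WithConv.ext
  ext h
  have h1 : tensorRep ρ σ h = ∑ i ∈ (ℛ k h).index,
      TensorProduct.map (ρ ((ℛ k h).left i)) (σ ((ℛ k h).right i)) := by
    simp only [tensorRep, AlgHom.comp_apply, Bialgebra.comulAlgHom_apply]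
    rw [← (ℛ k h).eq, map_sum, map_sum]
    rfl
  rw [conv_apply _ _ (ℛ k h)]
  change LinearMap.trace k (V ⊗[k] W) (tensorRep ρ σ h) = _
  rw [h1, map_sum]
  simp only [LinearMap.trace_tensorProduct']
  rfl

theorem trace_dualRep {V : Type*} [AddCommGroup V] [Module k V] [Module.Finite k V]
    (ρ : H →ₐ[k] Module.End k V) :
    toConv (LinearMap.trace k (Dual k V) ∘ₗ (dualRep ρ).toLinearMap) =
      dualAntipode k H (toConv (LinearMap.trace k V ∘ₗ ρ.toLinearMap)) := by
  apply WithConv.ext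
  ext h
  exact LinearMap.trace_transpose' _

/-- Λ acts as an idempotent, whose trace is its rank. -/
theorem IsIdempotentIntegral.exists_nat_trace {Λ : H} (hΛ : IsIdempotentIntegral k H Λ)
    {V : Type*} [AddCommGroup V] [Module k V] [Module.Finite k V] (ρ : H →ₐ[k] Module.End k V) :
    ∃ n : ℕ, (toConv (LinearMap.trace k V ∘ₗ ρ.toLinearMap)).ofConv Λ = n := by
  apply exists_nat_trace_of_isIdempotentElem (f := ρ Λ)
  rw [IsIdempotentElem, ← map_mul, hΛ.mul_left, hΛ.counit_eq_one, one_smul]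

end Multiplicity

/-! ### Trace functions and central elements -/

section TraceFunctions

open WithConv

variable {k : Type u} {H : Type v} [Field k] [Ring H] [HopfAlgebra k H]

theorem conv_apply_mul (p q : WithConv (H →ₗ[k] k)) {x y : H} {ι κ : Type*}
    (r : Coalgebra.Repr k x ι) (s : Coalgebra.Repr k y κ) :
    (p * q).ofConv (x * y) = ∑ i ∈ r.index, ∑ j ∈ s.index,
      p.ofConv (r.left i * s.left j) * q.ofConv (r.right i * s.right j) := by
  change LinearMap.mul' k k (TensorProduct.map p.ofConv q.ofConv (comul (R := k) (x * y))) = _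
  rw [Bialgebra.comul_mul, ← r.eq, ← s.eq, Finset.sum_mul_sum]
  simp

theorem conv_mul_comm {p q : WithConv (H →ₗ[k] k)} (hp : ∀ x y, p.ofConv (x * y) = p.ofConv (y * x))
    (hq : ∀ x y, q.ofConv (x * y) = q.ofConv (y * x)) (x y : H) :
    (p * q).ofConv (x * y) = (p * q).ofConv (y * x) := by
  rw [conv_apply_mul p q (ℛ k x) (ℛ k y), conv_apply_mul p q (ℛ k y) (ℛ k x), Finset.sum_comm]
  refine Finset.sum_congr rfl fun i _ => Finset.sum_congr rfl fun j _ => ?_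
  rw [hp, hq]

theorem dualAntipode_mul_comm {p : WithConv (H →ₗ[k] k)}
    (hp : ∀ x y, p.ofConv (x * y) = p.ofConv (y * x)) (x y : H) :
    (dualAntipode k H p).ofConv (x * y) = (dualAntipode k H p).ofConv (y * x) := by
  simp only [dualAntipode, LinearMap.comp_apply, antipode_mul_antidistrib]
  exact hp _ _

theorem character_mul_comm (V : Type w) [AddCommGroup V] [Module k V] [Module H V]
    [IsScalarTower k H V] (x y : H) :
    (character k H V).ofConv (x * y) = (character k H V).ofConv (y * x) := by
  change LinearMap.trace k V (rep k H V (x * y)) = LinearMap.trace k V (rep k H V (y * x))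
  rw [map_mul (rep k H V), map_mul (rep k H V), LinearMap.trace_mul_comm]

theorem character_apply (V : Type w) [AddCommGroup V] [Module k V] [Module H V]
    [IsScalarTower k H V] (x : H) :
    (character k H V).ofConv x = LinearMap.trace k V (rep k H V x) := rfl

theorem character_eq_one {V : Type w} [AddCommGroup V] [Module k V] [Module.Finite k V] [Module H V]
    [IsScalarTower k H V] [IsSimpleModule H V]
    (hV : ∀ (h : H) (x : V), h • x = (counit (R := k) h) • x) : character k H V = 1 := by
  apply WithConv.ext
  ext h
  have h1 : rep k H V h = (counit (R := k) h) • 1 := LinearMap.ext fun y => hV h y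
  rw [character_apply, h1, map_smul, LinearMap.trace_one, finrank_eq_one_of_trivial hV]
  simp

theorem dualAntipode_one : dualAntipode k H 1 = 1 := by
  apply WithConv.ext
  ext h
  change counit (R := k) (antipode k h) = counit (R := k) h
  simp

variable {Λ : H} (hΛ : IsIdempotentIntegral k H Λ) (hS : ∀ h : H, antipode k (antipode k h) = h)
include hΛ hS

/-- The two Casimir identities turn multiplication by h on either side of the slice into
multiplication by S(h) inside p, where sides do not matter. -/
theorem IsIdempotentIntegral.rightSlice_mem_center {p : H →ₗ[k] k}
    (hp : ∀ x y, p (x * y) = p (y * x)) (h : H) :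
    h * rightSlice p Λ = rightSlice p Λ * h := by
  have h1 := hΛ.rightSlice_mulLeft p (antipode k h)
  rw [hS] at h1
  rw [← h1, ← hΛ.rightSlice_mulRight]
  congr 2
  ext x
  exact hp _ _

theorem IsIdempotentIntegral.sum_casimir {ι : Type*} (r : Coalgebra.Repr k Λ ι)
    {M : Type*} [AddCommGroup M] [Module k M] (B : H →ₗ[k] H →ₗ[k] M) (h : H) :
    ∑ i ∈ r.index, B (h * r.left i) (antipode k (r.right i)) =
      ∑ i ∈ r.index, B (r.left i) (antipode k (r.right i) * h) := by
  have := hΛ.sum_casimir_left r (B.compl₂ (antipode k)) (antipode k h)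
  simpa only [LinearMap.compl₂_apply, antipode_mul_antidistrib, hS] using this

theorem IsIdempotentIntegral.sum_antipode_mul_left {ι : Type*} (r : Coalgebra.Repr k Λ ι) :
    ∑ i ∈ r.index, antipode k (r.right i) * r.left i = 1 := by
  have := congrArg (antipode k) (hΛ.sum_antipode_mul r)
  simpa [antipode_mul_antidistrib, hS] using this

end TraceFunctions

section Sandwich

variable {k : Type*} [Field k] {V W : Type*} [AddCommGroup V] [Module k V] [AddCommGroup W]
  [Module k W]

/-- `f ↦ A ∘ f ∘ B` -/
def sandwich (A : Module.End k W) (B : Module.End k V) : Module.End k (V →ₗ[k] W) where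
  toFun f := A ∘ₗ f ∘ₗ B
  map_add' f g := by ext; simp
  map_smul' c f := by ext; simp

theorem sandwich_apply (A : Module.End k W) (B : Module.End k V) (f : V →ₗ[k] W) :
    sandwich A B f = A ∘ₗ f ∘ₗ B := rfl

end Sandwich

/-! ### Averaging over Λ and orthogonality of characters -/

section Orthogonality

open WithConv

variable {k : Type u} {H : Type v} [Field k] [IsAlgClosed k] [CharZero k] [Ring H] [HopfAlgebra k H]
  {Λ : H} (hΛ : IsIdempotentIntegral k H Λ) (hS : ∀ h : H, antipode k (antipode k h) = h)

omit [IsAlgClosed k] in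
theorem finrank_ne_zero (k : Type u) (H : Type v) [Field k] [CharZero k] [Ring H] [HopfAlgebra k H]
    (V : Type w) [AddCommGroup V] [Module k V] [Module H V] [IsScalarTower k H V]
    [Module.Finite k V] [IsSimpleModule H V] : (finrank k V : k) ≠ 0 := by
  have := IsSimpleModule.nontrivial H V
  exact_mod_cast (Module.finrank_pos (R := k) (M := V)).ne'

theorem rep_eq_of_mem_center {V : Type w} [AddCommGroup V] [Module k V] [Module H V]
    [IsScalarTower k H V] [Module.Finite k V] [IsSimpleModule H V] {z : H}
    (hz : ∀ h, h * z = z * h) :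
    rep k H V z = ((character k H V).ofConv z / finrank k V) • 1 := by
  obtain ⟨c, hc⟩ := exists_smul_of_mem_center (k := k) (V := V) hz
  rw [character_apply, hc, map_smul, LinearMap.trace_one, smul_eq_mul,
    mul_div_cancel_right₀ _ (finrank_ne_zero k H V)]

include hΛ hS

omit [IsAlgClosed k] [CharZero k] in
/-- The average of a linear map with respect to the integral is a homomorphism. -/
theorem IsIdempotentIntegral.rep_comp_average {V W : Type w} [AddCommGroup V] [Module k V]
    [Module H V] [IsScalarTower k H V] [AddCommGroup W] [Module k W]
    [Module H W] [IsScalarTower k H W] {ι : Type*} (r : Coalgebra.Repr k Λ ι) (f : V →ₗ[k] W) (h : H) :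
    rep k H W h ∘ₗ (∑ i ∈ r.index,
      sandwich (rep k H W (r.left i)) (rep k H V (antipode k (r.right i))) f) =
    (∑ i ∈ r.index,
      sandwich (rep k H W (r.left i)) (rep k H V (antipode k (r.right i))) f) ∘ₗ rep k H V h := by
  let B : H →ₗ[k] H →ₗ[k] (V →ₗ[k] W) := LinearMap.mk₂ k
    (fun a b => rep k H W a ∘ₗ f ∘ₗ rep k H V b)
    (fun a a' b => by ext; simp) (fun c a b => by ext; simp)
    (fun a b b' => by rw [map_add, LinearMap.comp_add, LinearMap.comp_add])
    (fun c a b => by rw [map_smul, LinearMap.comp_smul, LinearMap.comp_smul])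
  have h1 := hΛ.sum_casimir hS r B h
  ext x
  have h2 := LinearMap.congr_fun h1 x
  simpa [B, sandwich_apply, LinearMap.sum_apply, mul_smul, Finset.smul_sum] using h2

/-- The average is a scalar by Schur, and it has the trace of f because Σ S(Λ₂)Λ₁ = 1, which relies
on S² = id. -/
theorem IsIdempotentIntegral.average_eq {V : Type w} [AddCommGroup V] [Module k V]
    [Module H V] [IsScalarTower k H V] [Module.Finite k V] [IsSimpleModule H V]
    {ι : Type*} (r : Coalgebra.Repr k Λ ι) (f : Module.End k V) :
    ∑ i ∈ r.index, sandwich (rep k H V (r.left i)) (rep k H V (antipode k (r.right i))) f =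
      (LinearMap.trace k V f / finrank k V) • 1 := by
  let φ : Module.End H V :=
    { toFun := (∑ i ∈ r.index,
        sandwich (rep k H V (r.left i)) (rep k H V (antipode k (r.right i))) f : Module.End k V)
      map_add' := map_add _
      map_smul' := fun h x => (LinearMap.congr_fun (hΛ.rep_comp_average hS r f h) x).symm }
  obtain ⟨c, hc⟩ := (IsSimpleModule.algebraMap_end_bijective_of_isAlgClosed k (A := H) (V := V)).2 φ
  have h1 : (∑ i ∈ r.index,
      sandwich (rep k H V (r.left i)) (rep k H V (antipode k (r.right i))) f : Module.End k V) =
      c • 1 := LinearMap.ext fun x => (LinearMap.congr_fun hc x).symm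
  have h2 : LinearMap.trace k V f = c * finrank k V := by
    have h3 := congrArg (LinearMap.trace k V) h1
    rw [map_smul, LinearMap.trace_one, smul_eq_mul] at h3
    rw [← h3, map_sum]
    calc LinearMap.trace k V f = LinearMap.trace k V (f * rep k H V 1) := by
          rw [map_one, mul_one]
      _ = ∑ i ∈ r.index, LinearMap.trace k V
          (f * (rep k H V (antipode k (r.right i)) * rep k H V (r.left i))) := by
          rw [← hΛ.sum_antipode_mul_left hS r, map_sum, Finset.mul_sum, map_sum]
          simp only [map_mul]
      _ = _ := by
          refine Finset.sum_congr rfl fun i _ => ?_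
          rw [← mul_assoc, LinearMap.trace_mul_comm]
          rfl
  rw [h1, h2, mul_div_cancel_right₀ _ (finrank_ne_zero k H V)]

/-- The left side is the trace of the averaging operator on End V, which is the rank-one map f ↦ (tr
f / d)·1. -/
theorem IsIdempotentIntegral.character_orthogonality_self (V : Type w) [AddCommGroup V] [Module k V]
    [Module H V] [IsScalarTower k H V] [Module.Finite k V] [IsSimpleModule H V] :
    (character k H V * dualAntipode k H (character k H V)).ofConv Λ = 1 := by
  let r := ℛ k Λ
  have h1 : (∑ i ∈ r.index, sandwich (rep k H V (r.left i)) (rep k H V (antipode k (r.right i))) :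
      Module.End k (V →ₗ[k] V)) =
      (LinearMap.trace k V).smulRight ((finrank k V : k)⁻¹ • (1 : Module.End k V)) := by
    apply LinearMap.ext
    intro f
    rw [LinearMap.sum_apply, hΛ.average_eq hS r f, LinearMap.smulRight_apply, smul_smul,
      div_eq_mul_inv]
  have h2 := congrArg (LinearMap.trace k (V →ₗ[k] V)) h1
  rw [map_sum, LinearMap.trace_smulRight, map_smul, LinearMap.trace_one, smul_eq_mul,
    inv_mul_cancel₀ (finrank_ne_zero k H V)] at h2
  rw [← h2, conv_apply _ _ r]
  exact Finset.sum_congr rfl fun i _ => (trace_eq_mul_trace fun f => rfl).symm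

theorem IsIdempotentIntegral.character_orthogonality_of_ne {V W : Type w} [AddCommGroup V]
    [Module k V] [Module H V] [IsScalarTower k H V] [Module.Finite k V] [IsSimpleModule H V]
    [AddCommGroup W] [Module k W] [Module H W] [IsScalarTower k H W] [Module.Finite k W]
    [IsSimpleModule H W] (hVW : ¬ Nonempty (V ≃ₗ[H] W)) :
    (character k H W * dualAntipode k H (character k H V)).ofConv Λ = 0 := by
  let r := ℛ k Λ
  have h1 : (∑ i ∈ r.index, sandwich (rep k H W (r.left i)) (rep k H V (antipode k (r.right i))) :
      Module.End k (V →ₗ[k] W)) = 0 := by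
    apply LinearMap.ext
    intro f
    let φ : V →ₗ[H] W :=
      { toFun := (∑ i ∈ r.index,
          sandwich (rep k H W (r.left i)) (rep k H V (antipode k (r.right i))) f : V →ₗ[k] W)
        map_add' := map_add _
        map_smul' := fun h x => (LinearMap.congr_fun (hΛ.rep_comp_average hS r f h) x).symm }
    have h0 : φ = 0 := φ.bijective_or_eq_zero.resolve_left fun hb =>
      hVW ⟨LinearEquiv.ofBijective φ hb⟩
    rw [LinearMap.sum_apply]
    exact LinearMap.ext fun x => LinearMap.congr_fun h0 x
  have h2 := congrArg (LinearMap.trace k (V →ₗ[k] W)) h1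
  rw [map_sum, map_zero] at h2
  rw [← h2, conv_apply _ _ r]
  exact Finset.sum_congr rfl fun i _ => (trace_eq_mul_trace fun f => rfl).symm

end Orthogonality

/-! ### Central idempotents as slices of Λ, and their commutators with Λ -/

section CentralIdempotents

open WithConv

variable {k : Type u} {H : Type v} [Field k] [IsAlgClosed k] [CharZero k] [Ring H] [HopfAlgebra k H]
  [IsSemisimpleRing H]
  {ι : Type*} [Fintype ι] {V : ι → Type w} [∀ i, AddCommGroup (V i)]
  [∀ i, Module k (V i)] [∀ i, Module H (V i)] [∀ i, IsScalarTower k H (V i)]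
  [∀ i, IsSimpleModule H (V i)] [∀ i, Module.Finite k (V i)]
  (hV : IsCompleteSetOfIrreducibles H V)

omit [IsAlgClosed k] [CharZero k] [Fintype ι] [∀ i, Module.Finite k (V i)] in
include hV in
theorem IsCompleteSetOfIrreducibles.eq_of_rep_eq {x y : H}
    (hxy : ∀ i, rep k H (V i) x = rep k H (V i) y) : x = y := by
  rw [← sub_eq_zero]
  apply hV.rep_injective (k := k)
  intro i
  rw [map_sub, hxy, sub_self]

-- Density supplies an element acting as 1 on V_i and 0 elsewhere; it is a central primitive
-- idempotent, so uniqueness identifies it.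
omit [CharZero k] in
include hV in
theorem IsCompleteSetOfIrreducibles.rep_centralIdempotent [DecidableEq ι] (i j : ι) :
    rep k H (V j) (centralIdempotent H (V i)) = if j = i then 1 else 0 := by
  obtain ⟨e, he, he0⟩ := hV.exists_rep_eq (k := k) i 1
  have hec : ∀ h, h * e = e * h := by
    intro h
    apply hV.eq_of_rep_eq (k := k)
    intro j
    rw [map_mul, map_mul]
    by_cases hj : j = i
    · subst hj
      rw [he, one_mul, mul_one]
    · rw [he0 j hj, zero_mul, mul_zero]
  have hprim : IsCentralPrimitiveIdempotent e := by
    refine ⟨Subring.mem_center_iff.2 hec, ?_, ?_, ?_⟩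
    · apply hV.eq_of_rep_eq (k := k)
      intro j
      rw [map_mul]
      by_cases hj : j = i
      · subst hj
        rw [he, one_mul]
      · rw [he0 j hj, zero_mul]
    · rintro rfl
      have := IsSimpleModule.nontrivial H (V i)
      rw [map_zero] at he
      exact zero_ne_one he
    · intro g hg hgi hge
      obtain ⟨c, hc⟩ := exists_smul_of_mem_center (k := k) (V := V i) (Subring.mem_center_iff.1 hg)
      have hg0 : ∀ j, j ≠ i → rep k H (V j) g = 0 := by
        intro j hj
        rw [← hge, map_mul, he0 j hj, mul_zero]
      have hcc : c * c = c := by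
        have := IsSimpleModule.nontrivial H (V i)
        have h1 := congrArg (rep k H (V i)) hgi.eq
        rw [map_mul, hc, smul_mul_smul_comm, one_mul] at h1
        have h2 : (c * c - c) • (1 : Module.End k (V i)) = 0 := by rw [sub_smul, h1, sub_self]
        exact sub_eq_zero.1 ((smul_eq_zero.1 h2).resolve_right one_ne_zero)
      rcases eq_or_ne c 0 with h0 | h0
      · left
        apply hV.eq_of_rep_eq (k := k)
        intro j
        rw [map_zero]
        by_cases hj : j = i
        · subst hj
          rw [hc, h0, zero_smul]
        · exact hg0 j hj
      · right
        have h1 : c = 1 := mul_left_cancel₀ h0 (by rw [hcc, mul_one])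
        apply hV.eq_of_rep_eq (k := k)
        intro j
        by_cases hj : j = i
        · subst hj
          rw [hc, h1, one_smul, he]
        · rw [hg0 j hj, he0 j hj]
  have heq : centralIdempotent H (V i) = e :=
    ((existsUnique_centralIdempotent H (V i)).choose_spec.2 e
      ⟨hprim, fun x => LinearMap.congr_fun he x⟩).symm
  rw [heq]
  by_cases hj : j = i
  · subst hj
    rw [he, if_pos rfl]
  · rw [he0 j hj, if_neg hj]

omit [CharZero k] in
include hV in
theorem IsCompleteSetOfIrreducibles.eq_sum_centralIdempotent {x : H} {c : ι → k}
    (hx : ∀ i, rep k H (V i) x = c i • 1) : x = ∑ i, c i • centralIdempotent H (V i) := by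
  classical
  apply hV.eq_of_rep_eq (k := k)
  intro j
  rw [hx, map_sum]
  simp [hV.rep_centralIdempotent]

omit [∀ i, IsScalarTower k H (V i)] [∀ i, Module.Finite k (V i)] [Fintype ι] [CharZero k]
  [IsAlgClosed k] [∀ i, Module k (V i)] in
theorem centralIdempotent_mem_center (i : ι) :
    centralIdempotent H (V i) ∈ Subalgebra.center k H := by
  have h := (existsUnique_centralIdempotent H (V i)).choose_spec.1.1.mem_center
  exact Subalgebra.mem_center_iff.2 (Subring.mem_center_iff.1 h)

/-- The elements `E i / d i ^ 2` form a basis of the center. -/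
def centerBasis (hV : IsCompleteSetOfIrreducibles H V) : Basis ι k (Subalgebra.center k H) := by
  classical
  refine Basis.mk (v := fun i => ((finrank k (V i) : k) ^ 2)⁻¹ •
    (⟨centralIdempotent H (V i), centralIdempotent_mem_center i⟩ : Subalgebra.center k H)) ?_ ?_
  · rw [Fintype.linearIndependent_iff]
    intro c hc i
    have h1 := congrArg (fun z : Subalgebra.center k H => rep k H (V i) z) hc
    simp only [AddSubmonoidClass.coe_finsetSum, SetLike.val_smul, map_sum, map_smul,
      hV.rep_centralIdempotent, ZeroMemClass.coe_zero, map_zero] at h1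
    have := IsSimpleModule.nontrivial H (V i)
    rw [Finset.sum_eq_single i (fun j _ hj => by rw [if_neg (Ne.symm hj), smul_zero, smul_zero])
      (by simp), if_pos rfl, smul_smul] at h1
    have h2 := (smul_eq_zero.1 h1).resolve_right one_ne_zero
    exact (mul_eq_zero.1 h2).resolve_right (inv_ne_zero (pow_ne_zero 2 (finrank_ne_zero k H (V i))))
  · rintro ⟨z, hz⟩ -
    have h1 := hV.eq_sum_centralIdempotent (k := k) (x := z) fun i =>
      rep_eq_of_mem_center (Subalgebra.mem_center_iff.1 hz)
    have h2 : (⟨z, hz⟩ : Subalgebra.center k H) =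
        ∑ i, ((character k H (V i)).ofConv z / finrank k (V i) * (finrank k (V i) : k) ^ 2) •
          (((finrank k (V i) : k) ^ 2)⁻¹ •
          (⟨centralIdempotent H (V i), centralIdempotent_mem_center i⟩ : Subalgebra.center k H)) := by
      apply Subtype.ext
      simp only [AddSubmonoidClass.coe_finsetSum, SetLike.val_smul]
      rw [h1]
      refine Finset.sum_congr rfl fun i _ => ?_
      have := finrank_ne_zero k H (V i)
      rw [smul_smul, mul_inv_cancel_right₀ (pow_ne_zero 2 this), ← h1]
    rw [h2]
    exact Submodule.sum_mem _ fun i _ => Submodule.smul_mem _ _ (Submodule.subset_span ⟨i, rfl⟩)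

theorem centerBasis_apply (i : ι) : (centerBasis (k := k) hV i : H) =
    ((finrank k (V i) : k) ^ 2)⁻¹ • centralIdempotent H (V i) := by
  simp [centerBasis]

include hV

variable {Λ : H} (hΛ : IsIdempotentIntegral k H Λ) (hS : ∀ h : H, antipode k (antipode k h) = h)
include hΛ hS

/-- The slice is central, and orthogonality computes its scalar on each V_i. -/
theorem IsCompleteSetOfIrreducibles.centralIdempotent_eq (j : ι) : centralIdempotent H (V j) =
    (finrank k (V j) : k) •
      rightSlice (dualAntipode k H (character k H (V j))).ofConv Λ := by
  classical
  apply hV.eq_of_rep_eq (k := k)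
  intro i
  rw [hV.rep_centralIdempotent, map_smul, rep_eq_of_mem_center
    (hΛ.rightSlice_mem_center hS (dualAntipode_mul_comm (character_mul_comm (V j)))),
    ← conv_eq_rightSlice]
  by_cases hij : i = j
  · subst hij
    have := finrank_ne_zero k H (V i)
    rw [if_pos rfl, hΛ.character_orthogonality_self hS, smul_smul, mul_one_div_cancel this, one_smul]
  · rw [if_neg hij, hΛ.character_orthogonality_of_ne hS fun h => hij (hV.pairwise_not_iso _ _ h).symm]
    simp

-- Inside {z, Λ} the legs of Λ average ρ(S z₂) to the scalar χ_i(S z₂)/d_i. Centrality of z plays no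
-- role.
omit hV [IsSemisimpleRing H] [Fintype ι] in
theorem IsIdempotentIntegral.rep_genCommutator (z : H) (i : ι) :
    rep k H (V i) (genCommutator k H z Λ) = (finrank k (V i) : k)⁻¹ •
      rep k H (V i) (rightSlice (dualAntipode k H (character k H (V i))).ofConv z) := by
  let r := ℛ k Λ
  rw [genCommutator_apply k H (ℛ k z) r, rightSlice_apply _ (ℛ k z), map_sum, map_sum,
    Finset.smul_sum]
  refine Finset.sum_congr rfl fun a _ => ?_
  have h1 := hΛ.average_eq hS r (rep k H (V i) (antipode k ((ℛ k z).right a)))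
  calc rep k H (V i) (∑ b ∈ r.index, (ℛ k z).left a * r.left b * antipode k ((ℛ k z).right a) *
        antipode k (r.right b))
      = rep k H (V i) ((ℛ k z).left a) * ∑ b ∈ r.index, sandwich (rep k H (V i) (r.left b))
          (rep k H (V i) (antipode k (r.right b))) (rep k H (V i) (antipode k ((ℛ k z).right a))) := by
        rw [map_sum, Finset.mul_sum]
        refine Finset.sum_congr rfl fun b _ => ?_
        simp only [map_mul, mul_assoc]
        rfl
    _ = _ := by
        rw [h1, map_smul, mul_smul_comm, mul_one, smul_smul, div_eq_inv_mul]
        rfl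

theorem IsCompleteSetOfIrreducibles.genCommutator_centralIdempotent (j : ι) :
    genCommutator k H (centralIdempotent H (V j)) Λ = ∑ i,
      ((finrank k (V j) : k) / (finrank k (V i) : k) ^ 2 *
        (character k H (V i) * dualAntipode k H (character k H (V i)) *
          dualAntipode k H (character k H (V j))).ofConv Λ) • centralIdempotent H (V i) := by
  apply hV.eq_sum_centralIdempotent
  intro i
  have hp : ∀ i, ∀ x y : H, (dualAntipode k H (character k H (V i))).ofConv (x * y) =
      (dualAntipode k H (character k H (V i))).ofConv (y * x) := fun i =>
    dualAntipode_mul_comm (character_mul_comm (V i))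
  rw [hΛ.rep_genCommutator hS, hV.centralIdempotent_eq hΛ hS j, map_smul, ← LinearMap.comp_apply,
    ← rightSlice_mul, map_smul, rep_eq_of_mem_center (hΛ.rightSlice_mem_center hS
      (conv_mul_comm (hp i) (hp j))), ← conv_eq_rightSlice, ← mul_assoc, smul_smul, smul_smul]
  congr 1
  have := finrank_ne_zero k H (V i)
  field_simp

end CentralIdempotents

/-! ### Rationality of the commutator matrix -/

section CommutatorMatrix

open WithConv

variable {k : Type u} {H : Type v} [Field k] [CharZero k] [Ring H] [HopfAlgebra k H]
  [IsSemisimpleRing H]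

theorem isIdempotentIntegral_idempotentIntegral (k : Type u) (H : Type v) [Field k] [Ring H]
    [HopfAlgebra k H] [IsSemisimpleRing H] :
    IsIdempotentIntegral k H (idempotentIntegral k H) :=
  (existsUnique_idempotentIntegral k H).choose_spec.1

theorem commutatorMatrix_nonneg {ι : Type*} (V : ι → Type w) [∀ i, AddCommGroup (V i)]
    [∀ i, Module k (V i)] [∀ i, Module H (V i)] [∀ i, IsScalarTower k H (V i)]
    [∀ i, Module.Finite k (V i)] (i j : ι) :
    ∃ q : ℚ, 0 ≤ q ∧ commutatorMatrix k H V i j = (q : k) := by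
  obtain ⟨n, hn⟩ := (isIdempotentIntegral_idempotentIntegral k H).exists_nat_trace
    (tensorRep (tensorRep (rep k H (V i)) (dualRep (rep k H (V i)))) (dualRep (rep k H (V j))))
  rw [trace_tensorRep, trace_tensorRep, trace_dualRep, trace_dualRep] at hn
  refine ⟨n / finrank k (V j), by positivity, ?_⟩
  push_cast
  rw [← hn]
  rfl

end CommutatorMatrix

/-! ### The commutator operator and its matrix -/

section CommutatorOperator

variable {k : Type u} {H : Type v} [Field k] [IsAlgClosed k] [CharZero k] [Ring H] [HopfAlgebra k H]
  [IsSemisimpleRing H]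
  {ι : Type*} [Fintype ι] {V : ι → Type w} [∀ i, AddCommGroup (V i)]
  [∀ i, Module k (V i)] [∀ i, Module H (V i)] [∀ i, IsScalarTower k H (V i)]
  [∀ i, IsSimpleModule H (V i)] [∀ i, Module.Finite k (V i)]
  (hV : IsCompleteSetOfIrreducibles H V) (hS : ∀ h : H, antipode k (antipode k h) = h)
include hV hS

theorem IsCompleteSetOfIrreducibles.genCommutator_centerBasis (j : ι) :
    genCommutator k H (centerBasis (k := k) hV j : H) (idempotentIntegral k H) =
      ((∑ i, commutatorMatrix k H V i j • centerBasis hV i : Subalgebra.center k H) : H) := by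
  rw [centerBasis_apply, map_smul, LinearMap.smul_apply,
    hV.genCommutator_centralIdempotent (isIdempotentIntegral_idempotentIntegral k H) hS,
    Finset.smul_sum, AddSubmonoidClass.coe_finsetSum]
  refine Finset.sum_congr rfl fun i _ => ?_
  rw [SetLike.val_smul, centerBasis_apply, smul_smul, smul_smul]
  congr 1
  have hj := finrank_ne_zero k H (V j)
  have hi := finrank_ne_zero k H (V i)
  change _ = _ / (finrank k (V j) : k) * _
  field_simp

theorem IsCompleteSetOfIrreducibles.genCommutator_mem_center (z : Subalgebra.center k H) :
    genCommutator k H (z : H) (idempotentIntegral k H) ∈ Subalgebra.center k H := by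
  rw [← (centerBasis (k := k) hV).sum_repr z, AddSubmonoidClass.coe_finsetSum, map_sum,
    LinearMap.sum_apply]
  refine sum_mem fun i _ => ?_
  rw [SetLike.val_smul, map_smul, LinearMap.smul_apply, hV.genCommutator_centerBasis hS]
  exact Subalgebra.smul_mem _ (SetLike.coe_mem _) _

/-- The operator `z ↦ {z, Λ}` on the center. -/
def commutatorOperator (hV : IsCompleteSetOfIrreducibles H V)
    (hS : ∀ h : H, antipode k (antipode k h) = h) :
    Subalgebra.center k H →ₗ[k] Subalgebra.center k H :=
  (((genCommutator k H).flip (idempotentIntegral k H)).comp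
    (Subalgebra.center k H).val.toLinearMap).codRestrict
      (Subalgebra.toSubmodule (Subalgebra.center k H)) (hV.genCommutator_mem_center hS)

theorem toMatrix_commutatorOperator [DecidableEq ι] :
    LinearMap.toMatrix (centerBasis hV) (centerBasis hV) (commutatorOperator hV hS) =
      commutatorMatrix k H V := by
  ext i j
  have h : commutatorOperator hV hS (centerBasis hV j) =
      ∑ i, commutatorMatrix k H V i j • centerBasis hV i :=
    Subtype.ext (hV.genCommutator_centerBasis hS j)
  rw [LinearMap.toMatrix_apply, h, Basis.repr_sum_self]

variable {i₀ : ι} (h₀ : ∀ (h : H) (x : V i₀), h • x = (counit (R := k) h) • x)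
include h₀

-- The last factor s(χ₀) is the unit of H*, so the entry is the orthogonality relation for V_i.
omit hV [Fintype ι] in
theorem commutatorMatrix_trivial_column (i : ι) : commutatorMatrix k H V i i₀ = 1 := by
  change (_ * _ * dualAntipode k H (character k H (V i₀))).ofConv _ / _ = _
  rw [character_eq_one h₀, dualAntipode_one, mul_one,
    (isIdempotentIntegral_idempotentIntegral k H).character_orthogonality_self hS,
    finrank_eq_one_of_trivial h₀, Nat.cast_one, div_one]

omit [Fintype ι] in
theorem commutatorMatrix_trivial_row [DecidableEq ι] (j : ι) :
    commutatorMatrix k H V i₀ j = if j = i₀ then 1 else 0 := by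
  split_ifs with hj
  · rw [hj, commutatorMatrix_trivial_column hS h₀]
  · change (character k H (V i₀) * dualAntipode k H (character k H (V i₀)) *
      dualAntipode k H (character k H (V j))).ofConv _ / _ = _
    have h1 := (isIdempotentIntegral_idempotentIntegral k H).character_orthogonality_of_ne hS
      fun h => hj (hV.pairwise_not_iso j i₀ h)
    rw [character_eq_one h₀] at h1 ⊢
    rw [dualAntipode_one, mul_one, h1, zero_div]

end CommutatorOperator

end

end HopfCommutator

theorem mainTheorem7 {k : Type u} {H : Type v} [Field k] [IsAlgClosed k] [CharZero k]
    [Ring H] [HopfAlgebra k H] [IsSemisimpleRing H]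
    {n : ℕ} [NeZero n] (V : Fin n → Type w) [∀ i, AddCommGroup (V i)]
    [∀ i, Module k (V i)] [∀ i, Module H (V i)] [∀ i, IsScalarTower k H (V i)]
    [∀ i, IsSimpleModule H (V i)]
    (hV : HopfCommutator.IsCompleteSetOfIrreducibles H V)
    (hV0 : ∀ (h : H) (x : V 0), h • x = (Coalgebra.counit (R := k) h) • x) :
    (∃ b : Module.Basis (Fin n) k (Subalgebra.center k H),
      (∀ i, (b i : H) =
        ((Module.finrank k (V i) : k) ^ 2)⁻¹ • HopfCommutator.centralIdempotent H (V i)) ∧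
      ∃ T : Subalgebra.center k H →ₗ[k] Subalgebra.center k H,
        (∀ z, (T z : H) = HopfCommutator.genCommutator k H (z : H)
          (HopfCommutator.idempotentIntegral k H)) ∧
        LinearMap.toMatrix b b T = HopfCommutator.commutatorMatrix k H V) ∧
    (∀ i j, ∃ q : ℚ, 0 ≤ q ∧ HopfCommutator.commutatorMatrix k H V i j = (q : k)) ∧
    (∀ i, HopfCommutator.commutatorMatrix k H V i 0 = 1) ∧
    (∀ (m : ℕ) (j : Fin n),
      (HopfCommutator.commutatorMatrix k H V ^ m) 0 j = if j = 0 then 1 else 0) ∧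
    (∀ m : ℕ, 0 < m → ∀ i, (HopfCommutator.commutatorMatrix k H V ^ m) i 0 =
      ∑ j, (HopfCommutator.commutatorMatrix k H V ^ (m - 1)) i j) ∧
    (∀ m : ℕ, 0 < m → ∀ i, ∃ q : ℚ, 0 < q ∧
      (HopfCommutator.commutatorMatrix k H V ^ m) i 0 = (q : k)) := by
  have hΛ := HopfCommutator.isIdempotentIntegral_idempotentIntegral k H
  have := hΛ.finite
  have : ∀ i, Module.Finite k (V i) := fun i =>
    HopfCommutator.finite_of_isSimpleModule k (R := H) (V i)
  have hS := hV.antipode_antipode hΛ 0 hV0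
  have hcol := HopfCommutator.commutatorMatrix_trivial_column hS hV0
  have hrow := HopfCommutator.commutatorMatrix_trivial_row hV hS hV0
  have hnonneg := HopfCommutator.commutatorMatrix_nonneg (k := k) (H := H) V
  exact ⟨⟨HopfCommutator.centerBasis hV, HopfCommutator.centerBasis_apply hV,
      HopfCommutator.commutatorOperator hV hS, fun _ => rfl,
      HopfCommutator.toMatrix_commutatorOperator hV hS⟩,
    hnonneg, hcol, HopfCommutator.pow_first_row hrow,
    fun _ hm => HopfCommutator.pow_first_column hcol hm,
    fun _ hm => HopfCommutator.pow_first_column_pos hcol hnonneg hm⟩
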